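/- **Setting.** A decision tree over $\mathbb R^d$ is a binary tree in which every internal node asks $x_i\ge b$ or $x_i\le b$ for some coordinate $i$ and some $b\in\mathbb R$, and every leaf carries a label in $\{0,1\}$. A tree $h$ assigns to $x\in\mathbb R^d$ the label $h(x)$ of the leaf that $x$ reaches. The size of a tree is its number of leaves. A label query on $x$ returns $h(x)$; a same-leaf query on $(x,x')$ tells whether $x$ and $x'$ reach the same leaf of $h$. **Learner.** A learner has a query tape, whose cells each store one point of $\mathbb R^d$, and a work tape, whose cells each store one bit. It is a finite program of unit-cost steps: draw a sample point into a query cell; remove or copy a stored point; make a label or same-leaf query on stored points and write the answer on the work tape; write or read a bit; test whether a query cell holds a point; compare one coordinate of two stored points; add, subtract, copy or compare numbers held in a fixed number of registers (tape addresses, bounded by the tape length $M$, and used to address the cells); branch on arbitrary predicates of the sample counter and the query counter, where these predicates may depend on $d,s,\varepsilon,\delta$. It is given $d$ and $s$. Its running time is the number of steps, its query complexity is the number of queries, and it uses memory $M$ if both tapes have length $M$ (the counters are not charged). When it halts, its memory represents a hypothesis $A:\mathbb R^d\to\{0,1,\bot\}$, which is evaluated at a point by a second program of the same kind that makes no queries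 and draws no samples. **Theorem.** There are a learner and an absolute constant $C$ such that for all integers $d,s\ge1$ and all $\varepsilon,\delta\in(0,1)$ there is a choice of the counter predicates for which the following holds for every decision tree $h$ over $\mathbb R^d$ with at most $s$ leaves. Write $\log^+ t=\max\{1,\log t\}$. 1. For every sequence of sample points, the learner halts after at most $$C\,ds^2\log^+\frac1{\varepsilon\delta}$$ queries, uses memory at most $C\,ds$, and has running time (including one evaluation of the output hypothesis) at most $$C\,\frac{d^2s^2}{\varepsilon}\,\log^+\!\Big(\frac{ds}{\varepsilon\delta}\Big)\,\log^+\!\Big(\frac1{\varepsilon\delta}\Big).$$ 2. (Reliable.) For every sequence of sample points and every $x\in\mathbb R^d$, the output hypothesis $A$ satisfies $A(x)\in\{h(x),\bot\}$. 3. (Probably useful.) For every Borel probability distribution $D$ on $\mathbb R^d$, if the sample points are drawn independently from $D$, then $$\Pr\Big[\Pr_{x\sim D}[A(x)=\bot]>\varepsilon\Big]<\delta .$$ -/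

import Mathlib

open MeasureTheory

/-- Points of the instance space `ℝ^d`. -/
abbrev Point (d : ℕ) : Type := Fin d → ℝ

/-! ### Decision trees, labels and the same-leaf relation -/

/-- A decision tree over `ℝ^d`: an internal node asks `x i ≥ b` (when `isGe`) or `x i ≤ b`
(otherwise); every leaf carries a binary label. -/
inductive DecisionTree (d : ℕ) : Type
  | leaf (label : Bool) : DecisionTree d
  | node (i : Fin d) (isGe : Bool) (b : ℝ) (yes no : DecisionTree d) : DecisionTree d

namespace DecisionTree

/-- The answer to the question `x i ≥ b` or `x i ≤ b` asked at an internal node. -/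
noncomputable def ask {d : ℕ} (i : Fin d) (isGe : Bool) (b : ℝ) (x : Point d) : Bool :=
  if isGe then decide (x i ≥ b) else decide (x i ≤ b)

/-- The label of the leaf that `x` reaches. -/
noncomputable def label {d : ℕ} : DecisionTree d → Point d → Bool
  | leaf l, _ => l
  | node i g b yes no, x => if ask i g b x then yes.label x else no.label x

/-- The leaf that `x` reaches, named by the sequence of answers on the way from the root. -/
noncomputable def leafOf {d : ℕ} : DecisionTree d → Point d → List Bool
  | leaf _, _ => []
  | node i g b yes no, x =>
      if ask i g b x then true :: yes.leafOf x else false :: no.leafOf x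

/-- The size of a decision tree: its number of leaves. -/
def size {d : ℕ} : DecisionTree d → ℕ
  | leaf _ => 1
  | node _ _ _ yes no => yes.size + no.size

/-- The answer of the same-leaf oracle on the pair `x, x'`. -/
noncomputable def sameLeaf {d : ℕ} (t : DecisionTree d) (x x' : Point d) : Bool :=
  decide (t.leafOf x = t.leafOf x')

end DecisionTree

/-! ### The learner: a program with a query tape, a work tape and two counters

A program is a finite text over unit-cost instructions.  It addresses the cells of the two tapes
through number registers, which can hold only numbers up to the tape length.  A program text is
finite, so it uses only finitely many registers. -/

/-- Unit-cost instructions.  All arguments `a b c j r` are names of registers; "cell `a`" is the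
tape cell whose address is the content of register `a`. -/
inductive Instr : Type
  /-- register `r` becomes the literal `n` -/
  | const (r n : ℕ) : Instr
  /-- register `r` becomes the content of `a` -/
  | copy (r a : ℕ) : Instr
  /-- add the content of `a` to register `r` -/
  | add (r a : ℕ) : Instr
  /-- subtract the content of `a` from register `r` (not below `0`) -/
  | sub (r a : ℕ) : Instr
  /-- write the bit `v` in work cell `a` -/
  | write (a : ℕ) (v : Bool) : Instr
  /-- draw a fresh sample point and store it in query cell `a` -/
  | sample (a : ℕ) : Instr
  /-- remove the point in query cell `a` -/
  | remove (a : ℕ) : Instr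
  /-- copy the content of query cell `a` into query cell `b` -/
  | copyPoint (a b : ℕ) : Instr
  /-- label query on the point in query cell `a`; the answer is written in work cell `c` -/
  | queryLabel (a c : ℕ) : Instr
  /-- same-leaf query on the points in query cells `a`, `b`; the answer goes to work cell `c` -/
  | queryLeaf (a b c : ℕ) : Instr

/-- Unit-cost tests. -/
inductive Test : Type
  /-- is the content of register `a` smaller than that of `b`? -/
  | lt (a b : ℕ) : Test
  /-- is the bit in work cell `a` equal to `1`? -/
  | bit (a : ℕ) : Test
  /-- does query cell `a` hold a point? -/
  | occupied (a : ℕ) : Test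
  /-- is the coordinate number (content of `j`) of the point in query cell `a` at most that of
  the point in query cell `b`? -/
  | coordLe (a b j : ℕ) : Test
  /-- the predicate number `tag` of the two counters -/
  | counters (tag : ℕ) : Test

/-- Programs. -/
inductive Prog : Type
  | instr (i : Instr) : Prog
  | seq (p q : Prog) : Prog
  | ite (t : Test) (p q : Prog) : Prog
  | while (t : Test) (p : Prog) : Prog

/-- What a run depends on besides the program. -/
structure Env (d : ℕ) : Type where
  /-- the target tree, accessible only through the two query instructions -/
  tree : DecisionTree d
  /-- the stream of unlabeled samples -/
  stream : ℕ → Point d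
  /-- the predicates of (sample counter, query counter) on which the control may branch -/
  ctl : ℕ → ℕ → ℕ → Bool
  /-- the length of the query tape and of the work tape -/
  mem : ℕ

/-- The state of a learner. -/
@[ext] structure LState (d : ℕ) : Type where
  /-- the registers -/
  regs : ℕ → ℕ
  /-- the query tape; `none` is an empty cell -/
  pts : ℕ → Option (Point d)
  /-- the work tape -/
  bits : ℕ → Bool
  /-- the sample counter -/
  samples : ℕ
  /-- the query counter -/
  queries : ℕ
  /-- the number of instructions and tests executed so far -/
  time : ℕ

namespace LState

/-- Initially the tapes are empty, the counters are `0`, and registers `0` and `1` hold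
`d` and `s`. -/
def init (d s : ℕ) : LState d where
  regs := fun r => if r = 0 then d else if r = 1 then s else 0
  pts := fun _ => none
  bits := fun _ => false
  samples := 0
  queries := 0
  time := 0

/-- One time unit passes. -/
def tick {d : ℕ} (σ : LState d) : LState d := { σ with time := σ.time + 1 }

/-- Put a test point in query cell `0`. -/
def load {d : ℕ} (σ : LState d) (x : Point d) : LState d :=
  { σ with pts := Function.update σ.pts 0 (some x) }

/-- The prediction encoded in register `0`: abstain, label `0`, or label `1`. -/
def output {d : ℕ} (σ : LState d) : Option Bool :=
  match σ.regs 0 with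
  | 0 => none
  | 1 => some false
  | _ => some true

/-- Set a register; impossible if the number exceeds the tape length. -/
def setReg {d : ℕ} (E : Env d) (σ : LState d) (r n : ℕ) : Option (LState d) :=
  if n ≤ E.mem then some { σ with regs := Function.update σ.regs r n } else none

/-- Set a work cell; impossible beyond the end of the tape. -/
def setBit {d : ℕ} (E : Env d) (σ : LState d) (addr : ℕ) (v : Bool) : Option (LState d) :=
  if addr < E.mem then some { σ with bits := Function.update σ.bits addr v } else none

/-- Set a query cell; impossible beyond the end of the tape. -/
def setPoint {d : ℕ} (E : Env d) (σ : LState d) (addr : ℕ) (p : Option (Point d)) :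
    Option (LState d) :=
  if addr < E.mem then some { σ with pts := Function.update σ.pts addr p } else none

end LState

/-- The effect of an instruction (apart from the passing of time); `none` means that it cannot be
executed: an address or number exceeds the tape length, or a query is made on an empty cell. -/
noncomputable def Instr.apply {d : ℕ} (E : Env d) (σ : LState d) : Instr → Option (LState d)
  | const r n => σ.setReg E r n
  | copy r a => σ.setReg E r (σ.regs a)
  | add r a => σ.setReg E r (σ.regs r + σ.regs a)
  | sub r a => σ.setReg E r (σ.regs r - σ.regs a)
  | write a v => σ.setBit E (σ.regs a) v
  | sample a =>
      LState.setPoint E { σ with samples := σ.samples + 1 } (σ.regs a) (some (E.stream σ.samples))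
  | remove a => σ.setPoint E (σ.regs a) none
  | copyPoint a b => σ.setPoint E (σ.regs b) (σ.pts (σ.regs a))
  | queryLabel a c =>
      match σ.pts (σ.regs a) with
      | some x => LState.setBit E { σ with queries := σ.queries + 1 } (σ.regs c) (E.tree.label x)
      | none => none
  | queryLeaf a b c =>
      match σ.pts (σ.regs a), σ.pts (σ.regs b) with
      | some x, some y =>
          LState.setBit E { σ with queries := σ.queries + 1 } (σ.regs c) (E.tree.sameLeaf x y)
      | _, _ => none

/-- The value of a test (`false` for a coordinate comparison that makes no sense). -/
noncomputable def Test.eval {d : ℕ} (E : Env d) (σ : LState d) : Test → Bool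
  | lt a b => decide (σ.regs a < σ.regs b)
  | bit a => σ.bits (σ.regs a)
  | occupied a => (σ.pts (σ.regs a)).isSome
  | coordLe a b j =>
      match σ.pts (σ.regs a), σ.pts (σ.regs b) with
      | some x, some y => if h : σ.regs j < d then decide (x ⟨_, h⟩ ≤ y ⟨_, h⟩) else false
      | _, _ => false
  | counters tag => E.ctl tag σ.samples σ.queries

/-- `Exec E p σ σ'`: started in `σ`, the program `p` halts in `σ'`.  Every instruction and every
evaluation of a test takes one unit of time. -/
inductive Exec {d : ℕ} (E : Env d) : Prog → LState d → LState d → Prop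
  | instr {i : Instr} {σ σ' : LState d} :
      i.apply E σ = some σ' → Exec E (.instr i) σ σ'.tick
  | seq {p q : Prog} {σ σ' σ'' : LState d} :
      Exec E p σ σ' → Exec E q σ' σ'' → Exec E (.seq p q) σ σ''
  | ite_true {t : Test} {p q : Prog} {σ σ' : LState d} :
      t.eval E σ = true → Exec E p σ.tick σ' → Exec E (.ite t p q) σ σ'
  | ite_false {t : Test} {p q : Prog} {σ σ' : LState d} :
      t.eval E σ = false → Exec E q σ.tick σ' → Exec E (.ite t p q) σ σ'
  | while_true {t : Test} {p : Prog} {σ σ' σ'' : LState d} :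
      t.eval E σ = true → Exec E p σ.tick σ' → Exec E (.while t p) σ' σ'' →
      Exec E (.while t p) σ σ''
  | while_false {t : Test} {p : Prog} {σ : LState d} :
      t.eval E σ = false → Exec E (.while t p) σ σ.tick

/-- Runs are deterministic. -/
theorem Exec.det {d : ℕ} {E : Env d} {p : Prog} {σ τ : LState d} (h : Exec E p σ τ) :
    ∀ {τ' : LState d}, Exec E p σ τ' → τ = τ' := by
  induction h with
  | instr h1 =>
      intro τ' h'
      cases h' with
      | instr h2 => rw [h1] at h2; cases h2; rfl
  | seq _ _ ih1 ih2 =>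
      intro τ' h'
      cases h' with
      | seq h1 h2 => cases ih1 h1; exact ih2 h2
  | ite_true ht _ ih =>
      intro τ' h'
      cases h' with
      | ite_true _ h1 => exact ih h1
      | ite_false hf _ => simp [ht] at hf
  | ite_false ht _ ih =>
      intro τ' h'
      cases h' with
      | ite_true hf _ => simp [ht] at hf
      | ite_false _ h1 => exact ih h1
  | while_true ht _ _ ih1 ih2 =>
      intro τ' h'
      cases h' with
      | while_true _ h1 h2 => cases ih1 h1; exact ih2 h2
      | while_false hf => simp [ht] at hf
  | while_false ht =>
      intro τ' h'
      cases h' with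
      | while_true hf _ _ => simp [ht] at hf
      | while_false _ => rfl

/-- A learner: a program that samples, queries and stores, and a program that evaluates the
hypothesis represented by the final content of the memory at a given test point. -/
structure Learner : Type where
  train : Prog
  classify : Prog

/-- In the environment `E` (target tree, sample stream, counter predicates, tape length) the
learner `L` halts after at most `Q` queries, its output hypothesis is `A`, and its running time,
including that of evaluating the hypothesis at any one point, is at most `T`.
The evaluation makes no queries and draws no samples. -/
def Learner.Produces {d : ℕ} (L : Learner) (E : Env d) (s : ℕ) (Q T : ℝ)
    (A : Point d → Option Bool) : Prop :=
  ∃ σ : LState d, Exec E L.train (LState.init d s) σ ∧ (σ.queries : ℝ) ≤ Q ∧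
    (σ.time : ℝ) ≤ T ∧
    ∀ x : Point d, ∃ τ : LState d, Exec E L.classify (σ.load x) τ ∧
      τ.samples = σ.samples ∧ τ.queries = σ.queries ∧ (τ.time : ℝ) ≤ T ∧ τ.output = A x

/-- With counter predicates `ctl`, the learner `L` actively RPU-learns the class of decision trees
with at most `s` leaves over `ℝ^d` up to `ε`, `δ`, with at most `Q` queries, in time at most `T`,
and with query and work tapes of length `M`.  The bounds and the reliability hold for every tree
and every sample stream; usefulness holds for every distribution of the samples. -/
def Learner.RPULearns (L : Learner) (d s : ℕ) (ctl : ℕ → ℕ → ℕ → Bool) (ε δ Q T : ℝ) (M : ℕ) :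
    Prop :=
  ∀ h : DecisionTree d, h.size ≤ s →
    ∃ A : (ℕ → Point d) → Point d → Option Bool,
      (∀ ω : ℕ → Point d,
        L.Produces { tree := h, stream := ω, ctl := ctl, mem := M } s Q T (A ω)) ∧
      (∀ (ω : ℕ → Point d) (x : Point d) (y : Bool), A ω x = some y → y = h.label x) ∧
      ∀ (D : Measure (Point d)) [IsProbabilityMeasure D],
        Measure.infinitePi (fun _ : ℕ => D)
            {ω | ENNReal.ofReal ε < D {x | A ω x = none}} < ENNReal.ofReal δ

/-! The learner keeps, for every leaf met so far, the samples that are extreme in one of the `2 * d`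
coordinate directions. They span a box, and since a leaf is an intersection of axis-parallel
half-spaces, the box lies inside the leaf (`leafOf_eq_of_between`). Predicting the stored label
inside the boxes and abstaining elsewhere is therefore always correct. A sample that falls into a
box needs no query and changes nothing. Any other sample, a miss, costs at most `s` same-leaf
queries to find its block and one label query. The query count is thus at most `s + 1` times the
number of misses, and everything rests on controlling misses.

Among any `n + 1` points, at most `k = 2 * d * s` lie outside the box spanned by the others in their
leaf, because each such point is strictly extreme in its leaf in some direction
(`ncard_not_covers_le`). By exchangeability the `(n + 1)`-st sample is a miss with probability at
most `k / (n + 1)`. An exponential-moment version of this argument gives `E 2 ^ misses ≤ (2 * N) ^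
k` after `k * N` samples (`lintegral_two_pow_misses_le`), so by Markov's inequality `k * v` misses
are unlikely once `2 ^ v` is large compared with `N / δ`. Conversely, as long as the uncovered mass
exceeds `ε`, each sample is a miss with probability above `ε`, so few misses together with large
uncovered mass are unlikely too (`measure_missMass_lt_le`). Both tails are `k`-th powers of
quantities that do not involve `k`. Hence `N` of order `log⁺ (1 / (ε * δ)) / ε` and `v` of order
`log⁺ (1 / (ε * δ))` suffice, with no logarithm of `d * s`.

The learner stops after `k * N` samples or after `(s + 1) * (k * v)` queries. Reaching the query cap
forces at least `k * v` misses, which is one of the two unlikely events. What remains is program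
verification: `Layout` says that the tapes store the extreme samples, `Layout.inBlock_iff`
identifies the box test with geometric covering, and each program is executed in a small logic that
counts steps. -/

/-! ### Misses of an exchangeable covering rule -/

/-- A covering rule: `miss n ω x` says that the first `n` entries of `ω` do not cover `x`.  It is
measurable, depends only on the first `n` entries and not on their order, is antitone in `n`, and
among `n + 1` points at most `k` are not covered by the others. -/
structure CoveringRule (X : Type*) [MeasurableSpace X] (k : ℕ) where
  miss : ℕ → (ℕ → X) → X → Prop
  measurableSet : ∀ n, MeasurableSet {z : (ℕ → X) × X | miss n z.1 z.2}
  update_iff : ∀ n m ω y x, n ≤ m → (miss n (Function.update ω m y) x ↔ miss n ω x)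
  anti : ∀ m n ω x, m ≤ n → miss n ω x → miss m ω x
  swap_iff : ∀ n a b ω x, a < n → b < n → (miss n (ω ∘ Equiv.swap a b) x ↔ miss n ω x)
  essential : ∀ n ω, {b ∈ (Finset.range (n + 1) : Set ℕ) |
    miss n (ω ∘ Equiv.swap b n) (ω b)}.ncard ≤ k

theorem lintegral_comp_swap {X : Type*} [MeasurableSpace X] (D : Measure X)
    [IsProbabilityMeasure D] (a b : ℕ) {f : (ℕ → X) → ENNReal} (hf : Measurable f) :
    ∫⁻ ω, f (ω ∘ Equiv.swap a b) ∂(Measure.infinitePi fun _ : ℕ => D) =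
      ∫⁻ ω, f ω ∂(Measure.infinitePi fun _ : ℕ => D) := by
  have h := Measure.map_infinitePi_infinitePi_of_inj (P := fun _ : ℕ => D)
    (Equiv.swap a b).injective
  conv_rhs => rw [← h]
  rw [lintegral_map hf (by fun_prop)]
  rfl

theorem measurable_update_uncurry {X : Type*} [MeasurableSpace X] (n : ℕ) :
    Measurable fun z : (ℕ → X) × X => Function.update z.1 n z.2 := by
  refine measurable_pi_iff.2 fun i => ?_
  rcases eq_or_ne i n with rfl | hi
  · simpa using measurable_snd
  · simp only [Function.update_of_ne hi]
    fun_prop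

/-- Entry `n` is independent of the other entries, so overwriting it with a fresh draw preserves the
law; it is enough to check this on cylinders. The purpose is to condition on everything except the
current sample. -/
theorem map_update_infinitePi_prod {X : Type*} [MeasurableSpace X] (D : Measure X)
    [IsProbabilityMeasure D] (n : ℕ) :
    ((Measure.infinitePi fun _ : ℕ => D).prod D).map
      (fun z : (ℕ → X) × X => Function.update z.1 n z.2) = Measure.infinitePi fun _ : ℕ => D := by
  refine Measure.eq_infinitePi _ fun s t ht => ?_
  rw [Measure.map_apply (measurable_update_uncurry n)
    (MeasurableSet.pi s.countable_toSet fun i _ => ht i)]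
  have hpre : (fun z : (ℕ → X) × X => Function.update z.1 n z.2) ⁻¹' Set.pi s t =
      (Set.pi (s.erase n : Finset ℕ) t) ×ˢ (if n ∈ s then t n else Set.univ) := by
    ext ⟨ω, y⟩
    simp only [Set.mem_preimage, Set.mem_pi, Set.mem_prod, Finset.mem_coe, Finset.mem_erase]
    constructor
    · intro h
      refine ⟨fun i hi => ?_, ?_⟩
      · simpa [hi.1] using h i hi.2
      · split_ifs with hn
        · simpa using h n hn
        · trivial
    · rintro ⟨h1, h2⟩ i hi
      rcases eq_or_ne i n with rfl | hne
      · simpa [hi] using h2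
      · simpa [hne] using h1 i ⟨hne, hi⟩
  rw [hpre, Measure.prod_prod, Measure.infinitePi_pi _ fun i _ => ht i]
  by_cases hn : n ∈ s
  · rw [if_pos hn, mul_comm, Finset.mul_prod_erase s (fun i => D (t i)) hn]
  · rw [if_neg hn, measure_univ, mul_one, Finset.erase_eq_of_notMem hn]

theorem lintegral_eq_lintegral_update {X : Type*} [MeasurableSpace X] (D : Measure X)
    [IsProbabilityMeasure D] (n : ℕ) {f : (ℕ → X) → ENNReal} (hf : Measurable f) :
    ∫⁻ ω, f ω ∂(Measure.infinitePi fun _ : ℕ => D) =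
      ∫⁻ ω, ∫⁻ y, f (Function.update ω n y) ∂D ∂(Measure.infinitePi fun _ : ℕ => D) := by
  conv_lhs => rw [← map_update_infinitePi_prod D n]
  rw [lintegral_map hf (measurable_update_uncurry n)]
  exact lintegral_prod _ (hf.comp (measurable_update_uncurry n)).aemeasurable

/-- Divided by `n !`, the product is `∏ (1 + min 1 (k / (i + 1)))`: the first `k` factors are `2`,
and the later ones grow like `(n / k) ^ k`. Equality holds at `n = k`, where the induction starts.
-/
theorem prod_add_min_mul_pow_le (k n : ℕ) (hkn : k ≤ n) :
    (∏ i ∈ Finset.range n, (i + 1 + min (i + 1) k)) * k ^ k ≤ 2 ^ k * n ^ k * n.factorial := by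
  induction n, hkn using Nat.le_induction with
  | base =>
      have : ∏ i ∈ Finset.range k, (i + 1 + min (i + 1) k) = 2 ^ k * k.factorial := by
        rw [← Finset.prod_range_add_one_eq_factorial, ← Finset.card_range k, ← Finset.prod_const,
          Finset.card_range, ← Finset.prod_mul_distrib]
        refine Finset.prod_congr rfl fun i hi => ?_
        rw [min_eq_left (Finset.mem_range.1 hi)]
        ring
      rw [this]
      exact le_of_eq (by ring)
  | succ n hkn ih =>
      -- A Bernoulli inequality, `1 + j / (n + 1) ≤ (1 + 1 / n) ^ j`, with denominators cleared.
      have key : ∀ j : ℕ, (n + 1 + j) * n ^ j ≤ (n + 1) ^ (j + 1) := by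
        intro j
        induction j with
        | zero => simp
        | succ j ihj =>
            calc (n + 1 + (j + 1)) * n ^ (j + 1) = ((n + 1 + (j + 1)) * n) * n ^ j := by ring
              _ ≤ ((n + 1 + j) * (n + 1)) * n ^ j := by gcongr ?_ * _; nlinarith
              _ = ((n + 1 + j) * n ^ j) * (n + 1) := by ring
              _ ≤ (n + 1) ^ (j + 1) * (n + 1) := by gcongr
              _ = _ := by ring
      rw [Finset.prod_range_succ, Nat.factorial_succ, min_eq_right (by omega)]
      calc (∏ i ∈ Finset.range n, (i + 1 + min (i + 1) k)) * (n + 1 + k) * k ^ k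
          = ((∏ i ∈ Finset.range n, (i + 1 + min (i + 1) k)) * k ^ k) * (n + 1 + k) := by ring
        _ ≤ (2 ^ k * n ^ k * n.factorial) * (n + 1 + k) := by gcongr
        _ = 2 ^ k * n.factorial * ((n + 1 + k) * n ^ k) := by ring
        _ ≤ 2 ^ k * n.factorial * (n + 1) ^ (k + 1) := by gcongr; exact key k
        _ = _ := by ring

namespace CoveringRule

variable {X : Type*} [MeasurableSpace X] {k : ℕ} (R : CoveringRule X k)

open scoped Classical in
/-- The number of the first `n` entries not covered by the preceding ones. -/
noncomputable def misses (n : ℕ) (ω : ℕ → X) : ℕ :=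
  ((Finset.range n).filter fun i => R.miss i ω (ω i)).card

open scoped Classical in
theorem misses_succ (n : ℕ) (ω : ℕ → X) :
    R.misses (n + 1) ω = R.misses n ω + if R.miss n ω (ω n) then 1 else 0 := by
  unfold misses
  rw [Finset.range_add_one, Finset.filter_insert]
  split_ifs with h
  · rw [Finset.card_insert_of_notMem (by simp)]
  · simp

theorem misses_mono (ω : ℕ → X) : Monotone fun n => R.misses n ω :=
  monotone_nat_of_le_succ fun n => by simp [misses_succ]

theorem measurableSet_miss (n : ℕ) : MeasurableSet {ω | R.miss n ω (ω n)} :=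
  (R.measurableSet n).preimage (measurable_id.prodMk (measurable_pi_apply n))

theorem measurable_misses (n : ℕ) : Measurable (R.misses n) := by
  classical
  induction n with
  | zero => exact measurable_const
  | succ n ih =>
      rw [show R.misses (n + 1) = fun ω => _ from funext fun ω => R.misses_succ n ω]
      exact ih.add (Measurable.ite (R.measurableSet_miss n) measurable_const measurable_const)

theorem misses_update (n : ℕ) (ω : ℕ → X) (y : X) :
    R.misses n (Function.update ω n y) = R.misses n ω := by
  classical
  unfold misses
  congr 1
  refine Finset.filter_congr fun i hi => ?_
  have hi' : i < n := Finset.mem_range.1 hi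
  rw [Function.update_of_ne hi'.ne, R.update_iff i n ω y _ hi'.le]

-- Composing with `swap b n` makes `ω b` the last of the `n + 1` points and leaves the others in
-- front. The factor is `2` for the at most `k` points not covered by the rest, and `1` for all
-- others.
open scoped Classical in
theorem sum_swap_le (n : ℕ) (ω : ℕ → X) :
    ∑ b ∈ Finset.range (n + 1),
      (if R.miss n (ω ∘ Equiv.swap b n) (ω b) then 2 else 1 : ENNReal) ≤
        ((n + 1 + min (n + 1) k : ℕ) : ENNReal) := by
  have h1 : ∀ b, (if R.miss n (ω ∘ Equiv.swap b n) (ω b) then 2 else 1 : ENNReal) =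
      ((1 + if R.miss n (ω ∘ Equiv.swap b n) (ω b) then 1 else 0 : ℕ) : ENNReal) := by
    intro b
    split_ifs <;> norm_num
  rw [Finset.sum_congr rfl fun b _ => h1 b, ← Nat.cast_sum, Nat.cast_le, Finset.sum_add_distrib,
    ← Finset.card_filter]
  simp only [Finset.sum_const, Finset.card_range, smul_eq_mul, mul_one]
  refine Nat.add_le_add_left (le_min ?_ ?_) _
  · exact (Finset.card_filter_le _ _).trans (by simp)
  · refine le_trans (le_of_eq ?_) (R.essential n ω)
    rw [← Set.ncard_coe_finset]
    congr 1
    ext b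
    simp

/-- Exponential moment of the number of misses, weighted by a function that is symmetric in the
first `n` entries. -/
theorem lintegral_two_pow_misses_mul_le (D : Measure X) [IsProbabilityMeasure D] (n : ℕ) :
    ∀ g : (ℕ → X) → ENNReal, Measurable g →
      (∀ a b ω, a < n → b < n → g (ω ∘ Equiv.swap a b) = g ω) →
      (∫⁻ ω, 2 ^ R.misses n ω * g ω ∂(Measure.infinitePi fun _ : ℕ => D)) * n.factorial ≤
        ((∏ i ∈ Finset.range n, (i + 1 + min (i + 1) k) : ℕ) : ENNReal) *
          ∫⁻ ω, g ω ∂(Measure.infinitePi fun _ : ℕ => D) := by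
  classical
  induction n with
  | zero => intro g _ _; simp [misses]
  | succ n ih =>
      intro g hg hsym
      set f : (ℕ → X) → ENNReal := fun ω => if R.miss n ω (ω n) then 2 else 1 with hf
      have hfm : Measurable f :=
        Measurable.ite (R.measurableSet_miss n) measurable_const measurable_const
      have h1 : ∀ ω, (2 : ENNReal) ^ R.misses (n + 1) ω * g ω =
          2 ^ R.misses n ω * (f ω * g ω) := by
        intro ω
        rw [R.misses_succ]
        by_cases h : R.miss n ω (ω n)
        · simp only [hf, if_pos h, pow_succ, mul_assoc]
        · simp [hf, if_neg h]
      -- Whether entry `n` is missed does not depend on the order of the preceding entries, so `f *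
      -- g` is again an admissible weight. Carrying the weight `g` is what allows the dependent
      -- factors to be peeled off one at a time, from the last.
      have h2 := ih (fun ω => f ω * g ω) (hfm.mul hg) (by
        intro a b ω ha hb
        rw [hsym a b ω (by omega) (by omega)]
        congr 1
        simp only [hf, R.swap_iff n a b ω _ ha hb, Function.comp_apply,
          Equiv.swap_apply_of_ne_of_ne (a := a) (b := b) (x := n) (by omega) (by omega)])
      -- Exchangeability: the integral is averaged over which of the `n + 1` entries stands last,
      -- and `g` is unaffected by these swaps.
      have h3 : ((n + 1 : ℕ) : ENNReal) *
          ∫⁻ ω, f ω * g ω ∂(Measure.infinitePi fun _ : ℕ => D) ≤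
            ((n + 1 + min (n + 1) k : ℕ) : ENNReal) *
              ∫⁻ ω, g ω ∂(Measure.infinitePi fun _ : ℕ => D) := by
        have hmeas : ∀ b, Measurable fun ω : ℕ → X =>
            f (ω ∘ Equiv.swap b n) * g (ω ∘ Equiv.swap b n) := fun b =>
          (hfm.mul hg).comp (measurable_pi_iff.2 fun i => measurable_pi_apply _)
        calc ((n + 1 : ℕ) : ENNReal) * ∫⁻ ω, f ω * g ω ∂(Measure.infinitePi fun _ : ℕ => D)
            = ∑ b ∈ Finset.range (n + 1), ∫⁻ ω, f (ω ∘ Equiv.swap b n) * g (ω ∘ Equiv.swap b n)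
                ∂(Measure.infinitePi fun _ : ℕ => D) := by
              rw [Finset.sum_congr rfl fun b _ =>
                lintegral_comp_swap D b n (f := fun ω => f ω * g ω) (hfm.mul hg)]
              simp
          _ = ∫⁻ ω, ∑ b ∈ Finset.range (n + 1), f (ω ∘ Equiv.swap b n) * g (ω ∘ Equiv.swap b n)
                ∂(Measure.infinitePi fun _ : ℕ => D) :=
              (lintegral_finsetSum _ fun b _ => hmeas b).symm
          _ ≤ ∫⁻ ω, ((n + 1 + min (n + 1) k : ℕ) : ENNReal) * g ω
                ∂(Measure.infinitePi fun _ : ℕ => D) := by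
              refine lintegral_mono fun ω => ?_
              refine le_trans (le_of_eq ?_) (mul_le_mul_left (R.sum_swap_le n ω) (g ω))
              rw [Finset.sum_mul]
              refine Finset.sum_congr rfl fun b hb => ?_
              rw [hsym b n ω (Finset.mem_range.1 hb) (by omega)]
              simp [hf]
          _ = _ := lintegral_const_mul _ hg
      rw [lintegral_congr h1, Finset.prod_range_succ, Nat.factorial_succ, Nat.cast_mul, Nat.cast_mul]
      generalize ((∏ i ∈ Finset.range n, (i + 1 + min (i + 1) k) : ℕ) : ENNReal) = P at h2 ⊢
      generalize ((n + 1 + min (n + 1) k : ℕ) : ENNReal) = c at h3 ⊢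
      generalize ((n + 1 : ℕ) : ENNReal) = m at h3 ⊢
      calc _ = m * ((∫⁻ ω, 2 ^ R.misses n ω * (f ω * g ω)
              ∂(Measure.infinitePi fun _ : ℕ => D)) * n.factorial) := by ring
        _ ≤ m * (P * ∫⁻ ω, f ω * g ω ∂(Measure.infinitePi fun _ : ℕ => D)) :=
            mul_le_mul_right h2 _
        _ = P * (m * ∫⁻ ω, f ω * g ω ∂(Measure.infinitePi fun _ : ℕ => D)) := by ring
        _ ≤ P * (c * ∫⁻ ω, g ω ∂(Measure.infinitePi fun _ : ℕ => D)) := mul_le_mul_right h3 _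
        _ = _ := by ring

theorem lintegral_two_pow_misses_le (D : Measure X) [IsProbabilityMeasure D] (hk : 0 < k) (N : ℕ)
    (hN : 0 < N) :
    ∫⁻ ω, 2 ^ R.misses (k * N) ω ∂(Measure.infinitePi fun _ : ℕ => D) ≤
      ((2 * N) ^ k : ℕ) := by
  have h1 := R.lintegral_two_pow_misses_mul_le D (k * N) (fun _ => 1) measurable_const
    fun _ _ _ _ _ => rfl
  simp only [mul_one, lintegral_one, measure_univ] at h1
  -- With `n = k * N` the factor `k ^ k` cancels, which leaves `(2 * N) ^ k`.
  have h2 : (∏ i ∈ Finset.range (k * N), (i + 1 + min (i + 1) k)) ≤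
      (2 * N) ^ k * (k * N).factorial := by
    have := prod_add_min_mul_pow_le k (k * N) (Nat.le_mul_of_pos_right k hN)
    refine Nat.le_of_mul_le_mul_right (this.trans (le_of_eq ?_)) (pow_pos hk k)
    rw [mul_pow, mul_pow]
    ring
  have h3 : (∫⁻ ω, 2 ^ R.misses (k * N) ω ∂(Measure.infinitePi fun _ : ℕ => D)) *
      ((k * N).factorial : ENNReal) ≤ ((2 * N) ^ k : ℕ) * ((k * N).factorial : ENNReal) := by
    refine h1.trans ?_
    rw [← Nat.cast_mul]
    exact_mod_cast h2
  exact (ENNReal.mul_le_mul_iff_left (by exact_mod_cast (k * N).factorial_ne_zero)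
    (ENNReal.natCast_ne_top _)).1 h3

theorem measurable_missMass (D : Measure X) [IsProbabilityMeasure D] (n : ℕ) :
    Measurable fun ω => D {x | R.miss n ω x} :=
  measurable_measure_prodMk_left (R.measurableSet n)

-- If `p > ε` is the missed mass, the integral equals `1 - p / 2`.
open scoped Classical in
theorem lintegral_half_of_missMass (D : Measure X) [IsProbabilityMeasure D] (n : ℕ) (ω : ℕ → X)
    {ε : ℝ} (hε : 0 < ε) (h : ENNReal.ofReal ε < D {x | R.miss n ω x}) :
    ∫⁻ y, (if R.miss n ω y then 1 / 2 else 1 : ENNReal) ∂D ≤ ENNReal.ofReal (1 - ε / 2) := by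
  have hm : MeasurableSet {x | R.miss n ω x} := (R.measurableSet n).preimage measurable_prodMk_left
  set P := {x | R.miss n ω x} with hP
  have h1 : ∀ y, (if R.miss n ω y then 1 / 2 else 1 : ENNReal) =
      P.indicator (fun _ => 1 / 2) y + Pᶜ.indicator (fun _ => 1) y := by
    intro y
    by_cases hy : R.miss n ω y <;> simp [hP, hy]
  rw [lintegral_congr h1, lintegral_add_left (measurable_const.indicator hm),
    lintegral_indicator_const hm, lintegral_indicator_const hm.compl, prob_compl_eq_one_sub hm,
    one_mul]
  have hp1 : D P ≤ 1 := prob_le_one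
  have hpt : D P ≠ ⊤ := measure_ne_top D P
  have hr : ENNReal.ofReal (D P).toReal = D P := ENNReal.ofReal_toReal hpt
  have hlt : ε < (D P).toReal := (ENNReal.ofReal_lt_iff_lt_toReal hε.le hpt).1 h
  have hle : (D P).toReal ≤ 1 := by simpa using ENNReal.toReal_mono ENNReal.one_ne_top hp1
  rw [← hr, show (1 / 2 : ENNReal) = ENNReal.ofReal (1 / 2) by
      rw [ENNReal.ofReal_div_of_pos two_pos]; simp,
    ← ENNReal.ofReal_one, ← ENNReal.ofReal_sub _ ENNReal.toReal_nonneg,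
    ← ENNReal.ofReal_mul (by norm_num),
    ← ENNReal.ofReal_add (by positivity) (by linarith)]
  exact ENNReal.ofReal_le_ofReal (by linarith)

open scoped Classical in
/-- As long as the missed mass exceeds `ε`, misses occur at rate at least `ε`. -/
theorem lintegral_half_pow_misses_le (D : Measure X) [IsProbabilityMeasure D] {ε : ℝ} (hε : 0 < ε)
    (n : ℕ) :
    ∫⁻ ω, (1 / 2) ^ R.misses n ω * (if ENNReal.ofReal ε < D {x | R.miss n ω x} then 1 else 0)
      ∂(Measure.infinitePi fun _ : ℕ => D) ≤ ENNReal.ofReal (1 - ε / 2) ^ n := by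
  have hpow : ∀ n, Measurable fun ω => ((1 / 2 : ENNReal)) ^ R.misses n ω := fun n =>
    (measurable_from_top (f := fun m : ℕ => (1 / 2 : ENNReal) ^ m)).comp (R.measurable_misses n)
  have hite : ∀ n, Measurable fun ω =>
      (if ENNReal.ofReal ε < D {x | R.miss n ω x} then 1 else 0 : ENNReal) := fun n =>
    Measurable.ite (measurableSet_lt measurable_const (R.measurable_missMass D n))
      measurable_const measurable_const
  induction n with
  | zero =>
      rw [pow_zero]
      refine (lintegral_mono (g := fun _ => 1) fun ω => ?_).trans (by simp)
      simp only [misses, Finset.range_zero, Finset.filter_empty, Finset.card_empty, pow_zero,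
        one_mul]
      split_ifs <;> simp
  | succ n ih =>
      set F : (ℕ → X) → ENNReal := fun ω => (1 / 2) ^ R.misses n ω *
        (if ENNReal.ofReal ε < D {x | R.miss n ω x} then 1 else 0) with hF
      have hFm : Measurable F := (hpow n).mul (hite n)
      set G : (ℕ → X) → ENNReal := fun ω =>
        F ω * (if R.miss n ω (ω n) then 1 / 2 else 1) with hG
      have hGm : Measurable G := hFm.mul
        (Measurable.ite (R.measurableSet_miss n) measurable_const measurable_const)
      calc _ ≤ ∫⁻ ω, G ω ∂(Measure.infinitePi fun _ : ℕ => D) := by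
            refine lintegral_mono fun ω => ?_
            -- Missed mass only decreases with `n`, so the indicator for `n + 1` is at most the one
            -- for `n`.
            have hsub : D {x | R.miss (n + 1) ω x} ≤ D {x | R.miss n ω x} :=
              measure_mono fun x hx => R.anti n (n + 1) ω x (Nat.le_succ n) hx
            simp only [hG, hF, R.misses_succ]
            by_cases h1 : ENNReal.ofReal ε < D {x | R.miss (n + 1) ω x}
            · rw [if_pos h1, if_pos (h1.trans_le hsub)]
              split_ifs <;> simp [pow_succ]
            · simp [h1]
        _ = ∫⁻ ω, ∫⁻ y, G (Function.update ω n y) ∂D ∂(Measure.infinitePi fun _ : ℕ => D) :=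
            lintegral_eq_lintegral_update D n hGm
        _ ≤ ∫⁻ ω, F ω * ENNReal.ofReal (1 - ε / 2) ∂(Measure.infinitePi fun _ : ℕ => D) := by
            refine lintegral_mono fun ω => ?_
            -- `F` depends only on the entries before `n`, so it comes out of the integral over the
            -- fresh entry.
            have hFu : ∀ y, F (Function.update ω n y) = F ω := by
              intro y
              simp only [hF, R.misses_update, R.update_iff n n ω y _ le_rfl]
            have hGu : ∀ y, G (Function.update ω n y) =
                F ω * (if R.miss n ω y then 1 / 2 else 1) := by
              intro y
              simp only [hG, hFu, R.update_iff n n ω y _ le_rfl, Function.update_self]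
            have hm : MeasurableSet {x | R.miss n ω x} :=
              (R.measurableSet n).preimage measurable_prodMk_left
            simp only [hGu]
            rw [lintegral_const_mul _ (Measurable.ite hm measurable_const measurable_const)]
            by_cases h1 : ENNReal.ofReal ε < D {x | R.miss n ω x}
            · gcongr
              exact R.lintegral_half_of_missMass D n ω hε h1
            · simp [hF, h1]
        _ = (∫⁻ ω, F ω ∂(Measure.infinitePi fun _ : ℕ => D)) * ENNReal.ofReal (1 - ε / 2) :=
            lintegral_mul_const _ hFm
        _ ≤ ENNReal.ofReal (1 - ε / 2) ^ n * ENNReal.ofReal (1 - ε / 2) := by gcongr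
        _ = _ := (pow_succ _ _).symm

/-- Markov's inequality for `2 ^ misses`. -/
theorem measure_le_misses_le (D : Measure X) [IsProbabilityMeasure D] (hk : 0 < k) (N : ℕ)
    (hN : 0 < N) (u : ℕ) :
    2 ^ u * (Measure.infinitePi fun _ : ℕ => D) {ω | u ≤ R.misses (k * N) ω} ≤
      ((2 * N) ^ k : ℕ) := by
  have hm : Measurable fun ω => (2 : ENNReal) ^ R.misses (k * N) ω :=
    (measurable_from_top (f := fun m : ℕ => (2 : ENNReal) ^ m)).comp (R.measurable_misses _)
  refine le_trans ?_ (R.lintegral_two_pow_misses_le D hk N hN)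
  refine le_trans ?_ (mul_meas_ge_le_lintegral hm (2 ^ u))
  gcongr with ω
  exact fun h => pow_le_pow_right₀ (by norm_num) h

/-- On this event the integrand of `lintegral_half_pow_misses_le` is at least `(1 / 2) ^ u`. -/
theorem measure_missMass_lt_le (D : Measure X) [IsProbabilityMeasure D] {ε : ℝ} (hε : 0 < ε)
    (n u : ℕ) :
    (Measure.infinitePi fun _ : ℕ => D)
      {ω | R.misses n ω < u ∧ ENNReal.ofReal ε < D {x | R.miss n ω x}} ≤
        2 ^ u * ENNReal.ofReal (1 - ε / 2) ^ n := by
  classical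
  set S := {ω | R.misses n ω < u ∧ ENNReal.ofReal ε < D {x | R.miss n ω x}} with hS
  have hSm : MeasurableSet S :=
    (measurableSet_lt (R.measurable_misses n) measurable_const).inter
      (measurableSet_lt measurable_const (R.measurable_missMass D n))
  have h1 : (1 / 2) ^ u * (Measure.infinitePi fun _ : ℕ => D) S ≤
      ENNReal.ofReal (1 - ε / 2) ^ n := by
    refine le_trans ?_ (R.lintegral_half_pow_misses_le D hε n)
    rw [← lintegral_indicator_const hSm]
    refine lintegral_mono fun ω => ?_
    by_cases h : ω ∈ S
    · rw [Set.indicator_of_mem h, if_pos h.2, mul_one]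
      exact pow_le_pow_right_of_le_one' (by simp) h.1.le
    · simp [Set.indicator_of_notMem h]
  calc (Measure.infinitePi fun _ : ℕ => D) S
      = 2 ^ u * ((1 / 2) ^ u * (Measure.infinitePi fun _ : ℕ => D) S) := by
        rw [← mul_assoc, ← mul_pow, one_div, ENNReal.mul_inv_cancel two_ne_zero ENNReal.ofNat_ne_top,
          one_pow, one_mul]
    _ ≤ _ := by gcongr

end CoveringRule

/-! ### Boxes spanned by samples within the leaves -/

namespace DecisionTree

variable {d : ℕ}

/-- The names of the leaves. -/
def leaves : DecisionTree d → Finset (List Bool)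
  | leaf _ => {[]}
  | node _ _ _ yes no => yes.leaves.image (true :: ·) ∪ no.leaves.image (false :: ·)

theorem card_leaves_le (t : DecisionTree d) : t.leaves.card ≤ t.size := by
  induction t with
  | leaf => simp [leaves, size]
  | node i g b yes no ih1 ih2 =>
      exact (Finset.card_union_le _ _).trans
        (add_le_add (Finset.card_image_le.trans ih1) (Finset.card_image_le.trans ih2))

theorem leafOf_mem_leaves (t : DecisionTree d) (x : Point d) : t.leafOf x ∈ t.leaves := by
  induction t with
  | leaf => simp [leaves, leafOf]
  | node i g b yes no ih1 ih2 =>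
      by_cases h : ask i g b x <;> simp [leaves, leafOf, h, ih1, ih2]

theorem label_eq_of_leafOf_eq (t : DecisionTree d) {x y : Point d}
    (h : t.leafOf x = t.leafOf y) : t.label x = t.label y := by
  induction t with
  | leaf => rfl
  | node i g b yes no ih1 ih2 =>
      by_cases hx : ask i g b x <;> by_cases hy : ask i g b y <;>
        simp [leafOf, label, hx, hy] at h ⊢
      · exact ih1 h
      · exact ih2 h

theorem ask_eq_of_between {i : Fin d} {g : Bool} {b : ℝ} {a c x : Point d} {v : Bool}
    (ha : ask i g b a = v) (hc : ask i g b c = v) (hax : a i ≤ x i) (hxc : x i ≤ c i) :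
    ask i g b x = v := by
  subst ha
  cases g <;> simp only [ask, Bool.false_eq_true, if_true, if_false, decide_eq_decide, ge_iff_le]
    at hc ⊢
  · exact ⟨fun h => hax.trans h, fun h => hxc.trans (hc.2 h)⟩
  · exact ⟨fun h => hc.1 (h.trans hxc), fun h => h.trans hax⟩

/-- A leaf contains the box spanned by any of its points. -/
theorem leafOf_eq_of_between (hd : 0 < d) (t : DecisionTree d) (S : Set (Point d)) (x : Point d) :
    ∀ l : List Bool, (∀ a ∈ S, t.leafOf a = l) →
      (∀ j, (∃ a ∈ S, a j ≤ x j) ∧ ∃ a ∈ S, x j ≤ a j) → t.leafOf x = l := by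
  induction t with
  | leaf =>
      intro l h1 h2
      obtain ⟨a, ha, -⟩ := (h2 ⟨0, hd⟩).1
      exact h1 a ha
  | node i g b yes no ih1 ih2 =>
      intro l h1 h2
      obtain ⟨⟨a, ha, hax⟩, ⟨c, hc, hxc⟩⟩ := h2 i
      have hla := h1 a ha
      by_cases hask : ask i g b a
      -- The leaf name starts with the answer at the root, so all of `S` answers alike; `x i` lies
      -- between two coordinates from `S`, which forces the same answer at `x`.
      · have hall : ∀ y ∈ S, ask i g b y = true := by
          intro y hy
          by_contra hn
          have := h1 y hy
          rw [← hla] at this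
          simp [leafOf, hask, hn] at this
        have hx := ask_eq_of_between hask (hall c hc) hax hxc
        simp only [leafOf, hask, if_true] at hla
        rw [← hla]
        simp only [leafOf, hx, if_true]
        congr 1
        refine ih1 _ (fun y hy => ?_) h2
        have := h1 y hy
        rw [← hla] at this
        simpa [leafOf, hall y hy] using this
      · have hall : ∀ y ∈ S, ask i g b y = false := by
          intro y hy
          by_contra hn
          have := h1 y hy
          rw [← hla] at this
          simp [leafOf, hask, Bool.eq_true_of_not_eq_false hn] at this
        have hx := ask_eq_of_between (hall a ha) (hall c hc) hax hxc
        simp only [leafOf, hask, if_false, Bool.false_eq_true] at hla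
        rw [← hla]
        simp only [leafOf, hx, if_false, Bool.false_eq_true]
        congr 1
        refine ih2 _ (fun y hy => ?_) h2
        have := h1 y hy
        rw [← hla] at this
        simpa [leafOf, hall y hy] using this

theorem measurableSet_ask (i : Fin d) (g : Bool) (b : ℝ) :
    MeasurableSet {x : Point d | ask i g b x = true} := by
  cases g
  · simpa [ask] using measurableSet_le (measurable_pi_apply i) measurable_const
  · simpa [ask] using measurableSet_le measurable_const (measurable_pi_apply i)

theorem measurableSet_leafOf_eq (t : DecisionTree d) :
    MeasurableSet {z : Point d × Point d | t.leafOf z.1 = t.leafOf z.2} := by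
  induction t with
  | leaf => simp [leafOf]
  | node i g b yes no ih1 ih2 =>
      have h1 : MeasurableSet {z : Point d × Point d | ask i g b z.1 = true} :=
        (measurableSet_ask i g b).preimage measurable_fst
      have h2 : MeasurableSet {z : Point d × Point d | ask i g b z.2 = true} :=
        (measurableSet_ask i g b).preimage measurable_snd
      convert ((h1.inter h2).inter ih1).union ((h1.compl.inter h2.compl).inter ih2) using 1
      ext ⟨x, y⟩
      by_cases hx : ask i g b x <;> by_cases hy : ask i g b y <;> simp [leafOf, hx, hy]

/-- The point `x` lies in the box spanned by those of the first `n` entries of `ω` that reach the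
same leaf as `x`. -/
def Covers (t : DecisionTree d) (n : ℕ) (ω : ℕ → Point d) (x : Point d) : Prop :=
  ∀ j, (∃ a < n, t.leafOf (ω a) = t.leafOf x ∧ ω a j ≤ x j) ∧
    ∃ a < n, t.leafOf (ω a) = t.leafOf x ∧ x j ≤ ω a j

theorem covers_mono {t : DecisionTree d} {m n : ℕ} {ω : ℕ → Point d} {x : Point d} (hmn : m ≤ n)
    (h : t.Covers m ω x) : t.Covers n ω x := fun j =>
  let ⟨⟨a, ha, h1⟩, ⟨b, hb, h2⟩⟩ := h j
  ⟨⟨a, ha.trans_le hmn, h1⟩, ⟨b, hb.trans_le hmn, h2⟩⟩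

theorem measurableSet_covers (t : DecisionTree d) (n : ℕ) :
    MeasurableSet {z : (ℕ → Point d) × Point d | t.Covers n z.1 z.2} := by
  have hl : ∀ a, MeasurableSet
      {z : (ℕ → Point d) × Point d | t.leafOf (z.1 a) = t.leafOf z.2} := fun a =>
    t.measurableSet_leafOf_eq.preimage (f := fun z : (ℕ → Point d) × Point d => (z.1 a, z.2))
      (by fun_prop)
  have hc : ∀ j : Fin d, Measurable fun z : (ℕ → Point d) × Point d => z.2 j := fun j => by fun_prop
  have he : ∀ (a : ℕ) (j : Fin d), Measurable fun z : (ℕ → Point d) × Point d => z.1 a j :=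
    fun a j => by fun_prop
  simp only [Covers, Set.ofPred_forall, Set.ofPred_and, Set.ofPred_exists]
  refine MeasurableSet.iInter fun j => (MeasurableSet.iUnion fun a => ?_).inter
    (MeasurableSet.iUnion fun a => ?_)
  · exact (MeasurableSet.const _).inter ((hl a).inter (measurableSet_le (he a j) (hc j)))
  · exact (MeasurableSet.const _).inter ((hl a).inter (measurableSet_le (hc j) (he a j)))

theorem covers_update (t : DecisionTree d) {n m : ℕ} (ω : ℕ → Point d) (y x : Point d)
    (hnm : n ≤ m) : t.Covers n (Function.update ω m y) x ↔ t.Covers n ω x := by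
  have h : ∀ a < n, Function.update ω m y a = ω a := fun a ha =>
    Function.update_of_ne (ha.trans_le hnm).ne _ _
  have hp : ∀ P : Point d → Prop,
      (∃ a < n, P (Function.update ω m y a)) ↔ ∃ a < n, P (ω a) := fun P =>
    exists_congr fun a => and_congr_right fun ha => by rw [h a ha]
  exact forall_congr' fun j => and_congr (hp fun y => t.leafOf y = t.leafOf x ∧ y j ≤ x j)
    (hp fun y => t.leafOf y = t.leafOf x ∧ x j ≤ y j)

theorem covers_swap (t : DecisionTree d) {n a b : ℕ} (ω : ℕ → Point d) (x : Point d)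
    (ha : a < n) (hb : b < n) : t.Covers n (ω ∘ Equiv.swap a b) x ↔ t.Covers n ω x := by
  have hlt : ∀ c < n, Equiv.swap a b c < n := by
    intro c hc
    rw [Equiv.swap_apply_def]
    split_ifs <;> assumption
  have hp : ∀ P : Point d → Prop,
      (∃ c < n, P ((ω ∘ Equiv.swap a b) c)) ↔ ∃ c < n, P (ω c) := fun P =>
    ⟨fun ⟨c, hc, h⟩ => ⟨_, hlt c hc, h⟩,
      fun ⟨c, hc, h⟩ => ⟨Equiv.swap a b c, hlt c hc, by simpa using h⟩⟩
  exact forall_congr' fun j => and_congr (hp fun y => t.leafOf y = t.leafOf x ∧ y j ≤ x j)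
    (hp fun y => t.leafOf y = t.leafOf x ∧ x j ≤ y j)

/-- A point not covered by the others is the strict minimum or maximum of its leaf in some
coordinate. A leaf has at most one strict extreme point in each of the `2 * d` directions, so
mapping the point to its leaf and direction is injective. -/
theorem ncard_not_covers_le (t : DecisionTree d) (n : ℕ) (ω : ℕ → Point d) :
    {b ∈ (Finset.range (n + 1) : Set ℕ) |
      ¬ t.Covers n (ω ∘ Equiv.swap b n) (ω b)}.ncard ≤ 2 * d * t.size := by
  classical
  set S := {b ∈ (Finset.range (n + 1) : Set ℕ) | ¬ t.Covers n (ω ∘ Equiv.swap b n) (ω b)} with hS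
  have key : ∀ b ∈ S, ∃ p : Fin d × Bool, ∀ a < n + 1, a ≠ b →
      t.leafOf (ω a) = t.leafOf (ω b) →
        if p.2 then ω b p.1 < ω a p.1 else ω a p.1 < ω b p.1 := by
    rintro b ⟨hb, hcov⟩
    have hb' : b < n + 1 := by simpa using hb
    -- The first `n` entries after the swap are exactly the `n + 1` points other than `ω b`.
    have hidx : ∀ a < n + 1, a ≠ b →
        ∃ c < n, (ω ∘ Equiv.swap b n) c = ω a := by
      intro a ha hab
      refine ⟨Equiv.swap b n a, ?_, by simp⟩
      rw [Equiv.swap_apply_def, if_neg hab]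
      split_ifs <;> omega
    simp only [Covers, not_forall, not_and_or] at hcov
    obtain ⟨j, hj | hj⟩ := hcov
    · refine ⟨(j, true), fun a ha hab hl => ?_⟩
      obtain ⟨c, hc, hca⟩ := hidx a ha hab
      by_contra hlt
      simp only [if_true, not_lt] at hlt
      exact hj ⟨c, hc, by rw [hca]; exact ⟨hl, hlt⟩⟩
    · refine ⟨(j, false), fun a ha hab hl => ?_⟩
      obtain ⟨c, hc, hca⟩ := hidx a ha hab
      by_contra hlt
      simp only [Bool.false_eq_true, if_false, not_lt] at hlt
      exact hj ⟨c, hc, by rw [hca]; exact ⟨hl, hlt⟩⟩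
  rcases S.eq_empty_or_nonempty with h0 | ⟨b₀, hb₀⟩
  · simp [h0]
  have : Nonempty (Fin d × Bool) := (key b₀ hb₀).nonempty
  choose! p hp using key
  have hle : S.ncard ≤ (t.leaves ×ˢ (Finset.univ : Finset (Fin d × Bool))).card := by
    rw [← Set.ncard_coe_finset]
    refine Set.ncard_le_ncard_of_injOn (fun b => (t.leafOf (ω b), p b)) ?_ ?_ (Finset.finite_toSet _)
    · intro b _
      simp [leafOf_mem_leaves]
    · intro a ha b hb hab
      by_contra hne
      simp only [Prod.mk.injEq] at hab
      have ha' : a < n + 1 := by simpa using ha.1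
      have hb' : b < n + 1 := by simpa using hb.1
      have h1 := hp a ha b hb' (Ne.symm hne) hab.1.symm
      have h2 := hp b hb a ha' hne hab.1
      rw [hab.2] at h1
      cases h : (p b).2 <;> simp only [h, if_true, if_false, Bool.false_eq_true] at h1 h2 <;>
        exact lt_asymm h1 h2
  refine hle.trans ?_
  rw [Finset.card_product, Finset.card_univ, Fintype.card_prod, Fintype.card_fin, Fintype.card_bool]
  calc t.leaves.card * (d * 2) ≤ t.size * (d * 2) := Nat.mul_le_mul_right _ t.card_leaves_le
    _ = _ := by ring

/-- Covering by the boxes spanned within the leaves. -/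
def coveringRule (t : DecisionTree d) {s : ℕ} (hs : t.size ≤ s) :
    CoveringRule (Point d) (2 * d * s) where
  miss n ω x := ¬ t.Covers n ω x
  measurableSet n := (t.measurableSet_covers n).compl
  update_iff _ _ ω y x h := not_congr (t.covers_update ω y x h)
  anti _ _ _ _ h := mt (covers_mono h)
  swap_iff _ _ _ ω x ha hb := not_congr (t.covers_swap ω x ha hb)
  essential n ω := (t.ncard_not_covers_le n ω).trans (Nat.mul_le_mul_left _ hs)

end DecisionTree

/-! ### Choice of the sample size and of the query cap -/

/-- The last two conclusions are the `k`-th roots of the two tail requirements, which is why `d` and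
`s` do not occur. -/
theorem exists_sampling_parameters {ε δ : ℝ} (hε : 0 < ε) (hε1 : ε < 1) (hδ : 0 < δ) :
    ∃ N v : ℕ, 0 < N ∧ (N : ℝ) ≤ 41 * max 1 (Real.log (1 / (ε * δ))) / ε ∧
      (v : ℝ) ≤ 21 * max 1 (Real.log (1 / (ε * δ))) ∧
      2 * (N : ℝ) ≤ δ / 4 * 2 ^ v ∧ 2 ^ v * (1 - ε / 2) ^ N ≤ δ / 4 := by
  set L := max 1 (Real.log (1 / (ε * δ))) with hL
  have hL1 : 1 ≤ L := le_max_left _ _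
  have hεδ : 0 < ε * δ := mul_pos hε hδ
  have hexp : 1 / (ε * δ) ≤ Real.exp L := by
    rw [← Real.log_le_iff_le_exp (by positivity)]
    exact le_max_right _ _
  have hq : 40 ≤ 40 * L / ε := by
    rw [le_div_iff₀ hε]
    nlinarith
  have hlog2 := Real.log_two_gt_d9
  have hlog2' := Real.log_two_lt_d9
  have hN1 : 40 * L / ε ≤ (⌈40 * L / ε⌉₊ : ℝ) := Nat.le_ceil _
  have hN2 : (⌈40 * L / ε⌉₊ : ℝ) ≤ 41 * L / ε := by
    have h1 : 1 ≤ L / ε := by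
      rw [le_div_iff₀ hε]
      linarith
    calc (⌈40 * L / ε⌉₊ : ℝ) ≤ 40 * L / ε + 1 := (Nat.ceil_lt_add_one (by positivity)).le
      _ ≤ 40 * L / ε + L / ε := by linarith
      _ = _ := by ring
  have hv1 : 20 * L ≤ (⌈20 * L⌉₊ : ℝ) := Nat.le_ceil _
  have hv2 : (⌈20 * L⌉₊ : ℝ) ≤ 20 * L + 1 := (Nat.ceil_lt_add_one (by positivity)).le
  have h2v : (2 : ℝ) ^ ⌈20 * L⌉₊ = Real.exp (Real.log 2 * ⌈20 * L⌉₊) := by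
    rw [Real.exp_mul, Real.exp_log two_pos, Real.rpow_natCast]
  have he1 : 2 ≤ Real.exp 1 := by linarith [Real.add_one_le_exp (1 : ℝ)]
  -- Since `0.69 < log 2 < 0.7`, one has `exp (13 * L) ≤ 2 ^ v ≤ exp (15 * L)`. The lower bound
  -- beats `2 * N ≤ 82 * L / ε`, using `1 / (ε * δ) ≤ exp L`. The upper bound is beaten by `(1 - ε /
  -- 2) ^ N ≤ exp (-20 * L)`.
  refine ⟨⌈40 * L / ε⌉₊, ⌈20 * L⌉₊, Nat.ceil_pos.2 (by positivity), hN2, by linarith, ?_, ?_⟩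
  · have h1 : Real.exp (13 * L) ≤ 2 ^ ⌈20 * L⌉₊ := by
      rw [h2v]
      exact Real.exp_le_exp.2 (by nlinarith)
    have h2 : 328 * L ≤ Real.exp (12 * L) := by
      have h3 : (2 : ℝ) ^ 11 ≤ Real.exp (11 * L) := by
        calc (2 : ℝ) ^ 11 ≤ Real.exp 1 ^ 11 := by gcongr
          _ = Real.exp 11 := by rw [← Real.exp_nat_mul]; norm_num
          _ ≤ _ := Real.exp_le_exp.2 (by linarith)
      have h4 : L ≤ Real.exp L := by linarith [Real.add_one_le_exp L]
      calc 328 * L ≤ 2 ^ 11 * L := by nlinarith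
        _ ≤ Real.exp (11 * L) * Real.exp L := by gcongr
        _ = _ := by rw [← Real.exp_add]; ring_nf
    have h5 : 1 / (ε * δ) * (328 * L) ≤ 2 ^ ⌈20 * L⌉₊ := by
      calc 1 / (ε * δ) * (328 * L) ≤ Real.exp L * Real.exp (12 * L) := by gcongr
        _ = Real.exp (13 * L) := by rw [← Real.exp_add]; ring_nf
        _ ≤ _ := h1
    calc 2 * (⌈40 * L / ε⌉₊ : ℝ) ≤ 2 * (41 * L / ε) := by gcongr
      _ = δ / 4 * (1 / (ε * δ) * (328 * L)) := by field_simp; ring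
      _ ≤ _ := by gcongr
  · have h1 : (1 - ε / 2) ^ ⌈40 * L / ε⌉₊ ≤ Real.exp (-(20 * L)) := by
      calc (1 - ε / 2) ^ ⌈40 * L / ε⌉₊ ≤ Real.exp (-(ε / 2)) ^ ⌈40 * L / ε⌉₊ := by
            gcongr
            · linarith
            · linarith [Real.add_one_le_exp (-(ε / 2))]
        _ = Real.exp (⌈40 * L / ε⌉₊ * -(ε / 2)) := (Real.exp_nat_mul _ _).symm
        _ ≤ _ := by
            refine Real.exp_le_exp.2 ?_
            have : 40 * L / ε * (ε / 2) ≤ ⌈40 * L / ε⌉₊ * (ε / 2) := by gcongr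
            have h2 : 40 * L / ε * (ε / 2) = 20 * L := by field_simp; norm_num
            linarith
    have h2 : (2 : ℝ) ^ ⌈20 * L⌉₊ ≤ Real.exp (15 * L) := by
      rw [h2v]
      exact Real.exp_le_exp.2 (by nlinarith)
    have h3 : 4 * Real.exp (-(2 * L)) ≤ 1 := by
      have h4 : (2 : ℝ) ^ 2 ≤ Real.exp (2 * L) := by
        calc (2 : ℝ) ^ 2 ≤ Real.exp 1 ^ 2 := by gcongr
          _ = Real.exp 2 := by rw [← Real.exp_nat_mul]; norm_num
          _ ≤ _ := Real.exp_le_exp.2 (by linarith)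
      rw [Real.exp_neg, ← div_eq_mul_inv, div_le_one (Real.exp_pos _)]
      linarith
    have h5 : Real.exp (-L) ≤ ε * δ := by
      rw [Real.exp_neg]
      exact inv_le_of_inv_le₀ hεδ (by simpa using hexp)
    have h6 : (2 : ℝ) ^ ⌈20 * L⌉₊ * (1 - ε / 2) ^ ⌈40 * L / ε⌉₊ ≤
        Real.exp (-(2 * L)) * Real.exp (-L) := by
      calc (2 : ℝ) ^ ⌈20 * L⌉₊ * (1 - ε / 2) ^ ⌈40 * L / ε⌉₊
          ≤ Real.exp (15 * L) * Real.exp (-(20 * L)) := by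
            gcongr
            exact pow_nonneg (by linarith) _
        _ = Real.exp (-(5 * L)) := by rw [← Real.exp_add]; ring_nf
        _ ≤ Real.exp (-(3 * L)) := Real.exp_le_exp.2 (by linarith)
        _ = _ := by rw [← Real.exp_add]; ring_nf
    have h7 : ε * δ ≤ δ := by nlinarith
    calc _ ≤ Real.exp (-(2 * L)) * Real.exp (-L) := h6
      _ ≤ (1 / 4) * δ := by
          gcongr
          · linarith
          · linarith
      _ = _ := by ring

/-- The event is split according to whether there are at least `k * v` misses. Each half has
probability at most a `k`-th power of something at most `δ / 4`, hence at most `δ / 4` because `k ≥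
1`; the total `δ / 2` is strictly below `δ`. -/
theorem CoveringRule.measure_failure_lt {X : Type*} [MeasurableSpace X] {k : ℕ}
    (R : CoveringRule X k) (D : Measure X) [IsProbabilityMeasure D] (hk : 0 < k) {ε δ : ℝ}
    (hε : 0 < ε) (hε1 : ε < 1) (hδ : 0 < δ) (hδ1 : δ < 1) {N v : ℕ} (hN : 0 < N)
    (h1 : 2 * (N : ℝ) ≤ δ / 4 * 2 ^ v) (h2 : 2 ^ v * (1 - ε / 2) ^ N ≤ δ / 4) :
    (Measure.infinitePi fun _ : ℕ => D)
      {ω | k * v ≤ R.misses (k * N) ω ∨ ENNReal.ofReal ε < D {x | R.miss (k * N) ω x}} <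
        ENNReal.ofReal δ := by
  have hpow : ∀ a : ℝ, 0 ≤ a → a ≤ δ / 4 → a ^ k ≤ δ / 4 := fun a ha h =>
    (pow_le_of_le_one ha (by linarith) hk.ne').trans h
  have hA : (Measure.infinitePi fun _ : ℕ => D) {ω | k * v ≤ R.misses (k * N) ω} ≤
      ENNReal.ofReal (δ / 4) := by
    have h3 := R.measure_le_misses_le D hk N hN (k * v)
    have h4 : (((2 * N) ^ k : ℕ) : ENNReal) ≤ 2 ^ (k * v) * ENNReal.ofReal (δ / 4) := by
      rw [show (2 : ENNReal) = ENNReal.ofReal 2 by simp, ← ENNReal.ofReal_pow (by norm_num),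
        ← ENNReal.ofReal_mul (by positivity), ← ENNReal.ofReal_natCast]
      refine ENNReal.ofReal_le_ofReal ?_
      push_cast
      calc (2 * (N : ℝ)) ^ k ≤ (δ / 4 * 2 ^ v) ^ k := by gcongr
        _ = (δ / 4) ^ k * 2 ^ (k * v) := by rw [mul_pow, ← pow_mul, mul_comm v k]
        _ ≤ δ / 4 * 2 ^ (k * v) := by gcongr; exact hpow _ (by positivity) le_rfl
        _ = _ := by ring
    exact (ENNReal.mul_le_mul_iff_right (by positivity)
      (ENNReal.pow_ne_top ENNReal.ofNat_ne_top)).1 (h3.trans h4)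
  have hB : (Measure.infinitePi fun _ : ℕ => D)
      {ω | R.misses (k * N) ω < k * v ∧ ENNReal.ofReal ε < D {x | R.miss (k * N) ω x}} ≤
        ENNReal.ofReal (δ / 4) := by
    refine (R.measure_missMass_lt_le D hε (k * N) (k * v)).trans ?_
    have h5 : 0 ≤ 1 - ε / 2 := by linarith
    rw [show (2 : ENNReal) = ENNReal.ofReal 2 by simp, ← ENNReal.ofReal_pow (by norm_num),
      ← ENNReal.ofReal_pow h5, ← ENNReal.ofReal_mul (by positivity)]
    refine ENNReal.ofReal_le_ofReal ?_
    rw [mul_comm k v, mul_comm k N, pow_mul, pow_mul, ← mul_pow]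
    exact hpow _ (by positivity) h2
  calc _ ≤ (Measure.infinitePi fun _ : ℕ => D) ({ω | k * v ≤ R.misses (k * N) ω} ∪
        {ω | R.misses (k * N) ω < k * v ∧ ENNReal.ofReal ε < D {x | R.miss (k * N) ω x}}) := by
        refine measure_mono fun ω hω => ?_
        rcases le_or_gt (k * v) (R.misses (k * N) ω) with h | h
        · exact Or.inl h
        · exact Or.inr ⟨h, hω.resolve_left h.not_ge⟩
    _ ≤ ENNReal.ofReal (δ / 4) + ENNReal.ofReal (δ / 4) :=
        (measure_union_le _ _).trans (add_le_add hA hB)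
    _ = ENNReal.ofReal (δ / 4 + δ / 4) := (ENNReal.ofReal_add (by positivity) (by positivity)).symm
    _ < ENNReal.ofReal δ := (ENNReal.ofReal_lt_ofReal_iff hδ).2 (by linarith)

/-! ### A program logic for total correctness with time bounds -/

namespace LState

variable {d : ℕ}

/-- One step that sets a register. -/
@[simp] def assign (σ : LState d) (r n : ℕ) : LState d :=
  { σ with regs := Function.update σ.regs r n, time := σ.time + 1 }

/-- One step that sets a query cell. -/
@[simp] def place (σ : LState d) (a : ℕ) (o : Option (Point d)) : LState d :=
  { σ with pts := Function.update σ.pts a o, time := σ.time + 1 }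

/-- One step that draws the sample point `x`. -/
@[simp] def draw (σ : LState d) (a : ℕ) (x : Point d) : LState d :=
  { σ with
    pts := Function.update σ.pts a (some x), samples := σ.samples + 1, time := σ.time + 1 }

/-- One step that stores the answer of a query. -/
@[simp] def answer (σ : LState d) (a : ℕ) (v : Bool) : LState d :=
  { σ with
    bits := Function.update σ.bits a v, queries := σ.queries + 1, time := σ.time + 1 }

attribute [simp] tick

end LState

/-- Started in `σ`, the program halts within `T` steps in a state that satisfies `Q`. -/
def Runs {d : ℕ} (E : Env d) (p : Prog) (σ : LState d) (T : ℕ) (Q : LState d → Prop) : Prop :=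
  ∃ τ, Exec E p σ τ ∧ τ.time ≤ σ.time + T ∧ Q τ

namespace Runs

variable {d : ℕ} {E : Env d} {p q : Prog} {σ : LState d} {T T' T₁ T₂ : ℕ}
  {Q Q' : LState d → Prop}

theorem mono (h : Runs E p σ T Q) (hT : T ≤ T') (hQ : ∀ τ, Q τ → Q' τ) : Runs E p σ T' Q' :=
  let ⟨τ, h1, h2, h3⟩ := h
  ⟨τ, h1, h2.trans (Nat.add_le_add_left hT _), hQ τ h3⟩

theorem seq (h : Runs E p σ T₁ fun τ => Runs E q τ T₂ Q) : Runs E (.seq p q) σ (T₂ + T₁) Q :=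
  let ⟨_, h1, h2, τ', h3, h4, h5⟩ := h
  ⟨τ', .seq h1 h3, by omega, h5⟩

theorem ite {t : Test} (h1 : t.eval E σ = true → Runs E p σ.tick T Q)
    (h2 : t.eval E σ = false → Runs E q σ.tick T Q) : Runs E (.ite t p q) σ (T + 1) Q := by
  cases h : t.eval E σ with
  | true =>
      obtain ⟨τ, h3, h4, h5⟩ := h1 h
      exact ⟨τ, .ite_true h h3, by simp at h4; omega, h5⟩
  | false =>
      obtain ⟨τ, h3, h4, h5⟩ := h2 h
      exact ⟨τ, .ite_false h h3, by simp at h4; omega, h5⟩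

/-- The iteration number indexes the invariant and `N` bounds it. Every round pays `b` for the body
and `1` for the test, and the final failing test pays one more. The invariant must survive `tick`,
since tests take time but change nothing else. -/
theorem loop {t : Test} (I : ℕ → LState d → Prop) (N b : ℕ)
    (htick : ∀ k τ, I k τ → I k τ.tick)
    (hstep : ∀ k τ, I k τ → t.eval E τ = true → k < N ∧ Runs E p τ.tick b (I (k + 1)))
    (h0 : I 0 σ) :
    Runs E (.while t p) σ (N * (b + 1) + 1) fun τ => ∃ k, I k τ ∧ t.eval E τ = false := by
  suffices ∀ n k σ, N - k = n → I k σ → Runs E (.while t p) σ (n * (b + 1) + 1)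
      fun τ => ∃ k, I k τ ∧ t.eval E τ = false from this N 0 σ rfl h0
  intro n
  induction n with
  | zero =>
      intro k σ hk hI
      cases h : t.eval E σ with
      | true => exact absurd (hstep k σ hI h).1 (by omega)
      | false =>
          exact ⟨σ.tick, .while_false h, by simp, k, htick k σ hI, by rw [← h]; cases t <;> rfl⟩
  | succ n ih =>
      intro k σ hk hI
      cases h : t.eval E σ with
      | true =>
          obtain ⟨-, σ', h1, h2, h3⟩ := hstep k σ hI h
          obtain ⟨τ, h4, h5, h6⟩ := ih (k + 1) σ' (by omega) h3
          refine ⟨τ, .while_true h h1 h4, ?_, h6⟩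
          simp only [LState.tick] at h2
          rw [add_mul, one_mul]
          omega
      | false =>
          exact ⟨σ.tick, .while_false h, by simp, k, htick k σ hI, by rw [← h]; cases t <;> rfl⟩

theorem instr {i : Instr} {τ : LState d} (h : i.apply E σ = some τ)
    (ht : τ.time = σ.time) (hQ : Q τ.tick) :
    Runs E (.instr i) σ 1 Q :=
  ⟨τ.tick, .instr h, by simp [ht], hQ⟩

theorem const {r n : ℕ} (h : n ≤ E.mem) (hQ : Q (σ.assign r n)) :
    Runs E (.instr (.const r n)) σ 1 Q :=
  instr (if_pos h) rfl hQ

theorem copy {r a : ℕ} (h : σ.regs a ≤ E.mem) (hQ : Q (σ.assign r (σ.regs a))) :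
    Runs E (.instr (.copy r a)) σ 1 Q :=
  instr (if_pos h) rfl hQ

theorem add {r a : ℕ} (h : σ.regs r + σ.regs a ≤ E.mem)
    (hQ : Q (σ.assign r (σ.regs r + σ.regs a))) : Runs E (.instr (.add r a)) σ 1 Q :=
  instr (if_pos h) rfl hQ

theorem sample {a : ℕ} (h : σ.regs a < E.mem)
    (hQ : Q (σ.draw (σ.regs a) (E.stream σ.samples))) : Runs E (.instr (.sample a)) σ 1 Q :=
  instr (if_pos h) rfl hQ

theorem copyPoint {a b : ℕ} (h : σ.regs b < E.mem)
    (hQ : Q (σ.place (σ.regs b) (σ.pts (σ.regs a)))) : Runs E (.instr (.copyPoint a b)) σ 1 Q :=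
  instr (if_pos h) rfl hQ

theorem queryLabel {a c : ℕ} {x : Point d} (hx : σ.pts (σ.regs a) = some x)
    (h : σ.regs c < E.mem) (hQ : Q (σ.answer (σ.regs c) (E.tree.label x))) :
    Runs E (.instr (.queryLabel a c)) σ 1 Q :=
  instr (τ := { σ with
      bits := Function.update σ.bits (σ.regs c) (E.tree.label x), queries := σ.queries + 1 })
    (by simp only [Instr.apply, hx]; exact if_pos h) rfl hQ

theorem queryLeaf {a b c : ℕ} {x y : Point d} (hx : σ.pts (σ.regs a) = some x)
    (hy : σ.pts (σ.regs b) = some y) (h : σ.regs c < E.mem)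
    (hQ : Q (σ.answer (σ.regs c) (E.tree.sameLeaf x y))) :
    Runs E (.instr (.queryLeaf a b c)) σ 1 Q :=
  instr (τ := { σ with
      bits := Function.update σ.bits (σ.regs c) (E.tree.sameLeaf x y), queries := σ.queries + 1 })
    (by simp only [Instr.apply, hx, hy]; exact if_pos h) rfl hQ

end Runs

/-- Comparison of coordinate `j` of the contents of two query cells. -/
noncomputable def leAt {d : ℕ} (o o' : Option (Point d)) (j : ℕ) : Bool :=
  match o, o' with
  | some x, some y => if h : j < d then decide (x ⟨j, h⟩ ≤ y ⟨j, h⟩) else false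
  | _, _ => false

theorem leAt_some {d : ℕ} (x y : Point d) (j : Fin d) :
    leAt (some x) (some y) j = decide (x j ≤ y j) := by
  simp [leAt]

theorem Test.eval_coordLe {d : ℕ} (E : Env d) (σ : LState d) (a b j : ℕ) :
    (Test.coordLe a b j).eval E σ =
      leAt (σ.pts (σ.regs a)) (σ.pts (σ.regs b)) (σ.regs j) := rfl

/-! ### The programs

Register `0` holds `d`, registers `2` and `3` hold `0` and `1`, register `4` holds the first free
address.  Query cell `0` holds the current point.  Each discovered leaf owns a block of `2 * d` query
cells, which hold for each coordinate a sample of this leaf with the least and one with the greatest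
coordinate; its label is stored in the work cell with the address of the block. -/

namespace BoxLearner

/-- No effect on the registers in use. -/
def skip : Prog := .instr (.const 11 0)

/-- Compares coordinate `r8` of the current point with the two points at `r7`. -/
def boxStep : Prog :=
  .seq (.ite (.coordLe 7 2 8) skip (.instr (.const 10 0))) <|
  .seq (.instr (.add 7 3)) <|
  .seq (.ite (.coordLe 2 7 8) skip (.instr (.const 10 0))) <|
  .seq (.instr (.add 7 3)) (.instr (.add 8 3))

/-- Tests whether the current point lies in the box of the block at `r5`. -/
def inBox : Prog :=
  .seq (.instr (.copy 7 5)) <| .seq (.instr (.const 8 0)) <| .seq (.instr (.const 10 1)) <|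
  .while (.lt 8 0) boxStep

/-- Tests one block and records the label in `r6`. -/
def scanStep : Prog :=
  .seq inBox <|
  .seq (.ite (.lt 2 10) (.ite (.bit 5) (.instr (.const 6 2)) (.instr (.const 6 1))) skip) <|
  .instr (.copy 5 7)

/-- Puts the prediction at the current point in `r6`. -/
def scan : Prog :=
  .seq (.instr (.const 6 0)) <| .seq (.instr (.copy 5 3)) <| .while (.lt 5 4) scanStep

/-- Compares the leaf of the current point with that of the block at `r5`. -/
def identifyStep : Prog :=
  .seq (.instr (.queryLeaf 2 5 2)) <| .seq (.ite (.bit 2) (.instr (.copy 9 5)) skip) <|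
  .seq (.instr (.add 5 0)) (.instr (.add 5 0))

/-- Puts in `r9` the block of the leaf of the current point, or the first free address. -/
def identify : Prog :=
  .seq (.instr (.copy 9 4)) <| .seq (.instr (.copy 5 3)) <| .while (.lt 5 4) identifyStep

/-- Extends the interval of coordinate `r8` at `r7` to the current point. -/
def updateStep : Prog :=
  .seq (.ite (.coordLe 7 2 8) skip (.instr (.copyPoint 2 7))) <|
  .seq (.instr (.add 7 3)) <|
  .seq (.ite (.coordLe 2 7 8) skip (.instr (.copyPoint 2 7))) <|
  .seq (.instr (.add 7 3)) (.instr (.add 8 3))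

/-- Extends the box of the block at `r9` to the current point. -/
def update : Prog :=
  .seq (.instr (.copy 7 9)) <| .seq (.instr (.const 8 0)) <| .while (.lt 8 0) updateStep

/-- Processes a point that is not covered. -/
def learn : Prog :=
  .seq identify <| .seq (.instr (.queryLabel 2 9)) <|
  .seq (.ite (.lt 9 4) skip (.seq (.instr (.add 4 0)) (.instr (.add 4 0)))) update

/-- Draws and processes one sample point. -/
def trainStep : Prog :=
  .seq (.instr (.sample 2)) <| .seq scan <| .ite (.lt 2 6) skip learn

/-- Maintains for each discovered leaf the box spanned by its samples. -/
def learner : Learner where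
  train := .seq (.instr (.const 2 0)) <| .seq (.instr (.const 3 1)) <|
    .seq (.instr (.const 4 1)) <| .while (.counters 0) trainStep
  classify := .seq scan (.instr (.copy 0 6))

/-! ### Correctness of the box test -/

variable {d : ℕ} {E : Env d} {σ : LState d}

/-- The states agree up to time and the registers from `K` on. -/
def Same (K : ℕ) (σ τ : LState d) : Prop :=
  τ.pts = σ.pts ∧ τ.bits = σ.bits ∧ τ.samples = σ.samples ∧ τ.queries = σ.queries ∧
    ∀ r < K, τ.regs r = σ.regs r

theorem Same.trans {K : ℕ} {σ τ υ : LState d} (h : Same K σ τ) (h' : Same K τ υ) : Same K σ υ :=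
  ⟨h'.1.trans h.1, h'.2.1.trans h.2.1, h'.2.2.1.trans h.2.2.1, h'.2.2.2.1.trans h.2.2.2.1,
    fun r hr => (h'.2.2.2.2 r hr).trans (h.2.2.2.2 r hr)⟩

theorem Same.mono {K K' : ℕ} {σ τ : LState d} (hK : K' ≤ K) (h : Same K σ τ) : Same K' σ τ :=
  ⟨h.1, h.2.1, h.2.2.1, h.2.2.2.1, fun r hr => h.2.2.2.2 r (hr.trans_le hK)⟩

theorem Same.assign {K r n : ℕ} (hr : K ≤ r) (σ : LState d) : Same K σ (σ.assign r n) :=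
  ⟨rfl, rfl, rfl, rfl, fun r' hr' => Function.update_of_ne (by omega) _ _⟩

theorem Same.tick (K : ℕ) (σ : LState d) : Same K σ σ.tick := ⟨rfl, rfl, rfl, rfl, fun _ _ => rfl⟩

theorem runs_skip {Q : LState d → Prop} (hQ : Q (σ.assign 11 0)) : Runs E skip σ 1 Q :=
  Runs.const (Nat.zero_le _) hQ

theorem runs_check {a b : ℕ} {Q : LState d → Prop}
    (hQ : ∀ τ, Same 10 σ τ → (τ.regs 10 =
      if leAt (σ.pts (σ.regs a)) (σ.pts (σ.regs b)) (σ.regs 8) = true then σ.regs 10 else 0) →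
      Q τ) :
    Runs E (.ite (.coordLe a b 8) skip (.instr (.const 10 0))) σ 2 Q := by
  refine Runs.ite (T := 1) (fun h => runs_skip (hQ _ ?_ ?_))
    (fun h => Runs.const (Nat.zero_le _) (hQ _ ?_ ?_)) <;> rw [Test.eval_coordLe] at *
  · exact (Same.tick 10 _).trans (Same.assign (by norm_num) _)
  · simp [h]
  · exact (Same.tick 10 _).trans (Same.assign (by norm_num) _)
  · simp [h]

/-- The current point lies between the points stored at `q + 2 * j` and `q + 2 * j + 1` in each
coordinate `j < k`. -/
def InBlock (pts : ℕ → Option (Point d)) (q k : ℕ) : Prop :=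
  ∀ j < k, leAt (pts (q + 2 * j)) (pts 0) j = true ∧ leAt (pts 0) (pts (q + 2 * j + 1)) j = true

theorem inBlock_succ (pts : ℕ → Option (Point d)) (q k : ℕ) :
    InBlock pts q (k + 1) ↔ InBlock pts q k ∧ leAt (pts (q + 2 * k)) (pts 0) k = true ∧
      leAt (pts 0) (pts (q + 2 * k + 1)) k = true :=
  ⟨fun h => ⟨fun j hj => h j (by omega), h k (by omega)⟩, fun h j hj =>
    (Nat.lt_succ_iff_lt_or_eq.1 hj).elim (h.1 j) fun e => e ▸ h.2⟩

open scoped Classical in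
theorem runs_boxStep {q k : ℕ} {pts : ℕ → Option (Point d)} {Q : LState d → Prop}
    (hp : σ.pts = pts) (h2 : σ.regs 2 = 0) (h3 : σ.regs 3 = 1) (h7 : σ.regs 7 = q + 2 * k)
    (h8 : σ.regs 8 = k) (h10 : σ.regs 10 = if InBlock pts q k then 1 else 0)
    (hmem : q + 2 * k + 2 ≤ E.mem)
    (hQ : ∀ τ, Same 7 σ τ → τ.regs 7 = q + 2 * (k + 1) → τ.regs 8 = k + 1 →
      (τ.regs 10 = if InBlock pts q (k + 1) then 1 else 0) → Q τ) :
    Runs E boxStep σ 7 Q := by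
  refine Runs.seq (T₁ := 2) (runs_check fun τ hs ht => Runs.seq (T₁ := 1) ?_)
  obtain ⟨ep, -, -, -, er⟩ := id hs
  have e2 := er 2 (by norm_num)
  have e3 := er 3 (by norm_num)
  have e7 := er 7 (by norm_num)
  have e8 := er 8 (by norm_num)
  refine Runs.add (by omega) (Runs.seq (T₁ := 2) (runs_check fun υ hs' hu => ?_))
  obtain ⟨fp, -, -, -, fr⟩ := id hs'
  have f2 := fr 2 (by norm_num)
  have f3 := fr 3 (by norm_num)
  have f7 := fr 7 (by norm_num)
  have f8 := fr 8 (by norm_num)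
  simp at f2 f3 f7 f8 hu
  refine Runs.seq (T₁ := 1) (Runs.add (by omega) (Runs.add (by simp; omega) (hQ _ ?_ ?_ ?_ ?_)))
  · exact (((hs.mono (by norm_num)).trans (Same.assign (by norm_num) _)).trans
      (hs'.mono (by norm_num))).trans ((Same.assign (by norm_num) _).trans
        (Same.assign (by norm_num) _))
  · simp; omega
  · simp; omega
  · simp [hu, ht, ep, e2, e3, e7, e8, h2, h3, h7, h8, h10, hp, inBlock_succ]
    grind

open scoped Classical in
theorem runs_inBox {Q : LState d → Prop} (h0 : σ.regs 0 = d) (h2 : σ.regs 2 = 0)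
    (h3 : σ.regs 3 = 1) (hmem : σ.regs 5 + 2 * d ≤ E.mem) (hmem1 : 1 ≤ E.mem)
    (hQ : ∀ τ, Same 7 σ τ → τ.regs 7 = σ.regs 5 + 2 * d →
      (τ.regs 10 = if InBlock σ.pts (σ.regs 5) d then 1 else 0) → Q τ) :
    Runs E inBox σ (8 * d + 4) Q := by
  unfold inBox
  refine Runs.mono (T := d * (7 + 1) + 1 + 1 + 1 + 1) (Q := fun τ => ∃ k, (Same 7 σ τ ∧
    τ.regs 7 = σ.regs 5 + 2 * k ∧ τ.regs 8 = k ∧ k ≤ d ∧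
    τ.regs 10 = if InBlock σ.pts (σ.regs 5) k then 1 else 0) ∧ Test.eval E τ (.lt 8 0) = false)
    ?_ (by omega) ?_
  · refine Runs.seq (Runs.copy (by omega) (Runs.seq (Runs.const (by omega) (Runs.seq
      (Runs.const hmem1 (Runs.loop _ _ _ (fun _ _ h => h) ?_ ?_))))))
    · rintro k τ ⟨hs, h7, h8, hk, h10⟩ ht
      obtain ⟨hp, hb, hs', hq, hr⟩ := id hs
      have hkd : k < d := by simpa [Test.eval, h8, hr, h0] using ht
      exact ⟨hkd, runs_boxStep (q := σ.regs 5) (k := k) (pts := σ.pts) hp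
        ((hr 2 (by norm_num)).trans h2) ((hr 3 (by norm_num)).trans h3) h7 h8 h10 (by omega)
        fun υ h1 h2 h3 h4 => ⟨hs.trans ((Same.tick 7 τ).trans h1), h2, h3, hkd, h4⟩⟩
    · exact ⟨((Same.assign (by norm_num) _).trans (Same.assign (by norm_num) _)).trans
        (Same.assign (by norm_num) _), by simp [InBlock]⟩
  · rintro τ ⟨k, ⟨hs, h7, h8, hk, h10⟩, ht⟩
    have hkd : k = d := by
      simp [Test.eval, h8, hs.2.2.2.2, h0] at ht
      omega
    subst hkd
    exact hQ τ hs h7 h10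

end BoxLearner

/-! ### Block addresses, scanning, leaf identification and box extension -/

namespace BoxLearner

variable {d : ℕ} {E : Env d} {σ : LState d}

theorem add_mul_le_of_lt {b m : ℕ} (h : b < m) : 1 + 2 * d * b + 2 * d ≤ 1 + 2 * d * m := by
  nlinarith [Nat.mul_le_mul_left (2 * d) (Nat.succ_le_of_lt h)]

theorem lt_of_add_mul_lt {b m : ℕ} (h : 1 + 2 * d * b < 1 + 2 * d * m) : b < m :=
  lt_of_mul_lt_mul_left (a := 2 * d) (by omega) (Nat.zero_le _)

/-- Turns the exit test on addresses into an exact block count; positive `d` makes the block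
addresses distinct. -/
theorem eq_of_not_add_mul_lt (hd : 0 < d) {b m : ℕ} (hb : b ≤ m)
    (h : ¬ 1 + 2 * d * b < 1 + 2 * d * m) : b = m :=
  hb.antisymm (le_of_mul_le_mul_left (a := 2 * d) (by omega) (by omega))

/-- The registers hold `d`, `0`, `1` and the first free address behind `m` blocks. -/
def Ready (m : ℕ) (σ : LState d) : Prop :=
  σ.regs 0 = d ∧ σ.regs 2 = 0 ∧ σ.regs 3 = 1 ∧ σ.regs 4 = 1 + 2 * d * m

theorem Ready.of_same {m : ℕ} {τ : LState d} (h : Ready m σ) (hs : ∀ r < 5, τ.regs r = σ.regs r) :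
    Ready m τ :=
  ⟨(hs 0 (by norm_num)).trans h.1, (hs 2 (by norm_num)).trans h.2.1,
    (hs 3 (by norm_num)).trans h.2.2.1, (hs 4 (by norm_num)).trans h.2.2.2⟩

theorem exists_lt_succ_iff {P : ℕ → Prop} {k : ℕ} :
    (∃ b < k + 1, P b) ↔ (∃ b < k, P b) ∨ P k :=
  ⟨fun ⟨b, hb, h⟩ => (Nat.lt_succ_iff_lt_or_eq.1 hb).elim (fun hb => .inl ⟨b, hb, h⟩)
    fun e => .inr (e ▸ h), fun h => h.elim (fun ⟨b, hb, h⟩ => ⟨b, by omega, h⟩)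
    fun h => ⟨k, by omega, h⟩⟩

open scoped Classical in
/-- The prediction at the current point, when the points of all boxes around it have label `v`. -/
noncomputable def prediction (pts : ℕ → Option (Point d)) (m : ℕ) (v : Bool) : ℕ :=
  if ∃ b < m, InBlock pts (1 + 2 * d * b) d then (if v then 2 else 1) else 0

open scoped Classical in
theorem prediction_succ (pts : ℕ → Option (Point d)) (k : ℕ) (v : Bool) :
    prediction pts (k + 1) v = if InBlock pts (1 + 2 * d * k) d then (if v then 2 else 1)
      else prediction pts k v := by
  unfold prediction
  simp only [exists_lt_succ_iff]
  by_cases h : InBlock pts (1 + 2 * d * k) d <;> simp only [h, or_true, or_false, if_true, if_false]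

open scoped Classical in
theorem runs_scanStep {m k : ℕ} {v : Bool} {Q : LState d → Prop} (hr : Ready m σ) (hk : k < m)
    (hmem : 2 * d * m + 2 ≤ E.mem) (h5 : σ.regs 5 = 1 + 2 * d * k)
    (h6 : σ.regs 6 = prediction σ.pts k v)
    (hv : InBlock σ.pts (1 + 2 * d * k) d → σ.bits (1 + 2 * d * k) = v)
    (hQ : ∀ τ, Same 5 σ τ → τ.regs 5 = 1 + 2 * d * (k + 1) →
      τ.regs 6 = prediction σ.pts (k + 1) v → Q τ) :
    Runs E scanStep σ (8 * d + 8) Q := by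
  have hlt := add_mul_le_of_lt (d := d) hk
  unfold scanStep
  refine Runs.mono (T := 1 + 3 + (8 * d + 4)) ?_ (by omega) fun _ h => h
  refine Runs.seq (runs_inBox hr.1 hr.2.1 hr.2.2.1 (by omega) (by omega) fun τ hs h7 h10 => ?_)
  obtain ⟨ep, eb, -, -, er⟩ := id hs
  have e2 := er 2 (by norm_num)
  have e5 := er 5 (by norm_num)
  have e6 := er 6 (by norm_num)
  rw [hr.2.1] at e2
  rw [h5] at e5 h7 h10
  rw [h6] at e6
  have h7' : τ.regs 7 = 1 + 2 * d * (k + 1) := by rw [h7]; ring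
  refine Runs.seq ?_
  have hs5 : Same 5 σ τ := hs.mono (by norm_num)
  refine Runs.ite (T := 2) (fun ht => Runs.ite (T := 1) (fun hb => ?_) fun hb => ?_) fun ht => ?_
  · replace ht : InBlock σ.pts (1 + 2 * d * k) d := by
      by_contra hn
      simp [Test.eval, e2, h10, hn] at ht
    simp only [Test.eval, e5, eb, LState.tick, hv ht] at hb
    subst hb
    refine Runs.const (by omega) (Runs.copy (by simp; omega) (hQ _ ?_ ?_ ?_))
    · exact ((hs5.trans (Same.tick 5 _)).trans (Same.tick 5 _)).trans
        ((Same.assign (by norm_num) _).trans (Same.assign le_rfl _))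
    · simp [h7']
    · simp [prediction_succ, ht]
  · replace ht : InBlock σ.pts (1 + 2 * d * k) d := by
      by_contra hn
      simp [Test.eval, e2, h10, hn] at ht
    simp only [Test.eval, e5, eb, LState.tick, hv ht] at hb
    subst hb
    refine Runs.const (by omega) (Runs.copy (by simp; omega) (hQ _ ?_ ?_ ?_))
    · exact ((hs5.trans (Same.tick 5 _)).trans (Same.tick 5 _)).trans
        ((Same.assign (by norm_num) _).trans (Same.assign le_rfl _))
    · simp [h7']
    · simp [prediction_succ, ht]
  · simp [Test.eval, e2, h10] at ht
    refine Runs.mono (T := 1) (runs_skip (Runs.copy (by simp; omega) (hQ _ ?_ ?_ ?_)))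
      (by norm_num) fun _ h => h
    · exact (hs5.trans (Same.tick 5 _)).trans
        ((Same.assign (by norm_num) _).trans (Same.assign le_rfl _))
    · simp [h7']
    · simp [prediction_succ, ht, e6]

/-- The scan runs through all blocks and later hits overwrite earlier ones. This is harmless because
all blocks whose box contains the point carry the same label `v`. -/
theorem runs_scan {m : ℕ} {v : Bool} {Q : LState d → Prop} (hd : 0 < d) (hr : Ready m σ)
    (hmem : 2 * d * m + 2 ≤ E.mem)
    (hv : ∀ b < m, InBlock σ.pts (1 + 2 * d * b) d → σ.bits (1 + 2 * d * b) = v)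
    (hQ : ∀ τ, Same 5 σ τ → τ.regs 6 = prediction σ.pts m v → Q τ) :
    Runs E scan σ (m * (8 * d + 9) + 3) Q := by
  unfold scan
  refine Runs.mono (T := m * (8 * d + 8 + 1) + 1 + 1 + 1) (Q := fun τ => ∃ k, (Same 5 σ τ ∧
    τ.regs 5 = 1 + 2 * d * k ∧ k ≤ m ∧ τ.regs 6 = prediction σ.pts k v) ∧
    Test.eval E τ (.lt 5 4) = false) ?_ (by linarith) ?_
  · refine Runs.seq (Runs.const (by omega) (Runs.seq (Runs.copy (by simp [hr.2.2.1]; omega)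
      (Runs.loop _ _ _ (fun _ _ h => h) ?_ ?_))))
    · rintro k τ ⟨hs, h5, hk, h6⟩ ht
      obtain ⟨ep, eb, -, -, er⟩ := id hs
      have hr' := hr.of_same er
      have hkm : k < m := by
        simp only [Test.eval, h5, hr'.2.2.2, decide_eq_true_eq] at ht
        exact lt_of_add_mul_lt ht
      refine ⟨hkm, runs_scanStep (σ := τ.tick) (v := v) hr' hkm hmem h5 (by simp [h6, ep])
        (by simpa [ep, eb] using hv k hkm) fun υ h1 h2 h3 =>
          ⟨hs.trans ((Same.tick 5 τ).trans h1), h2, hkm, by simpa [ep] using h3⟩⟩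
    · refine ⟨(Same.assign (by norm_num) _).trans (Same.assign le_rfl _), ?_, Nat.zero_le _, ?_⟩
      · simp [hr.2.2.1]
      · simp [prediction]
  · rintro τ ⟨k, ⟨hs, h5, hk, h6⟩, ht⟩
    have hkm : k = m := by
      simp only [Test.eval, h5, (hr.of_same hs.2.2.2.2).2.2.2, decide_eq_false_iff_not] at ht
      exact eq_of_not_add_mul_lt hd hk ht
    subst hkm
    exact hQ τ hs h6

/-- Agreement of the states up to registers from `5` on, work cell `0`, and `q` queries. -/
def SameButQueries (q : ℕ) (σ τ : LState d) : Prop :=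
  τ.pts = σ.pts ∧ (∀ c, c ≠ 0 → τ.bits c = σ.bits c) ∧ τ.samples = σ.samples ∧
    τ.queries = σ.queries + q ∧ ∀ r < 5, τ.regs r = σ.regs r

/-- The block number `a / (2 * d)` is the one among the first `k` whose leaf is `l`, or `a = e`
if there is none. -/
def Located (ℓ : ℕ → List Bool) (l : List Bool) (d k e a : ℕ) : Prop :=
  (∃ b < k, ℓ b = l ∧ a = 1 + 2 * d * b) ∨ (∀ b < k, ℓ b ≠ l) ∧ a = e

/-- One same-leaf query against the first cell of a block decides the whole block, since all its
cells hold points of one leaf. The answer goes to work cell `0`, which no block uses. -/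
theorem runs_identifyStep {m k : ℕ} {x y : Point d} {ℓ : ℕ → List Bool} {Q : LState d → Prop}
    (hr : Ready m σ) (hk : k < m) (hmem : 2 * d * m + 2 ≤ E.mem) (hx : σ.pts 0 = some x)
    (hy : σ.pts (1 + 2 * d * k) = some y) (hℓ : E.tree.leafOf y = ℓ k)
    (h5 : σ.regs 5 = 1 + 2 * d * k)
    (h9 : Located ℓ (E.tree.leafOf x) d k (1 + 2 * d * m) (σ.regs 9))
    (hQ : ∀ τ, SameButQueries 1 σ τ → τ.regs 5 = 1 + 2 * d * (k + 1) →
      Located ℓ (E.tree.leafOf x) d (k + 1) (1 + 2 * d * m) (τ.regs 9) → Q τ) :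
    Runs E identifyStep σ 5 Q := by
  have hlt := add_mul_le_of_lt (d := d) hk
  have hsucc : 1 + 2 * d * k + d + d = 1 + 2 * d * (k + 1) := by ring
  obtain ⟨r0, r2, -, -⟩ := id hr
  refine Runs.seq (T₁ := 1) (Runs.queryLeaf (x := x) (y := y) (by rw [r2, hx]) (by rw [h5, hy])
    (by omega) (Runs.seq (T₁ := 2) (Runs.ite (T := 1) (fun ht => ?_) fun ht => ?_)))
  all_goals simp [Test.eval, r2, DecisionTree.sameLeaf, hℓ] at ht
  · refine Runs.copy (by simp; omega) (Runs.seq (T₁ := 1) (Runs.add (by simp [h5, r0]; omega)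
      (Runs.add (by simp [h5, r0]; omega) (hQ _ ?_ ?_ ?_))))
    · refine ⟨rfl, fun c hc => by simp [r2, hc], rfl, rfl, fun r hr => ?_⟩
      simp [show r ≠ 5 by omega, show r ≠ 9 by omega]
    · simp [h5, r0, hsucc]
    · exact .inl ⟨k, by omega, ht.symm, by simp [h5]⟩
  · refine runs_skip (Runs.seq (T₁ := 1) (Runs.add (by simp [h5, r0]; omega)
      (Runs.add (by simp [h5, r0]; omega) (hQ _ ?_ ?_ ?_))))
    · refine ⟨rfl, fun c hc => by simp [r2, hc], rfl, rfl, fun r hr => ?_⟩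
      simp [show r ≠ 5 by omega, show r ≠ 11 by omega]
    · simp [h5, r0, hsucc]
    · rcases h9 with ⟨b, hb, h1, h2⟩ | ⟨h1, h2⟩
      · exact .inl ⟨b, by omega, h1, by simpa using h2⟩
      · refine .inr ⟨fun b hb => ?_, by simpa using h2⟩
        rcases Nat.lt_succ_iff_lt_or_eq.1 hb with hb | rfl
        · exact h1 b hb
        · exact Ne.symm ht

theorem runs_identify {m : ℕ} {x : Point d} {ℓ : ℕ → List Bool} {Q : LState d → Prop}
    (hd : 0 < d) (hr : Ready m σ) (hmem : 2 * d * m + 2 ≤ E.mem) (hx : σ.pts 0 = some x)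
    (hℓ : ∀ b < m, ∃ y, σ.pts (1 + 2 * d * b) = some y ∧ E.tree.leafOf y = ℓ b)
    (hQ : ∀ τ, SameButQueries m σ τ →
      Located ℓ (E.tree.leafOf x) d m (1 + 2 * d * m) (τ.regs 9) → Q τ) :
    Runs E identify σ (m * 6 + 3) Q := by
  unfold identify
  refine Runs.mono (T := m * (5 + 1) + 1 + 1 + 1) (Q := fun τ => ∃ k, (SameButQueries k σ τ ∧
    τ.regs 5 = 1 + 2 * d * k ∧ k ≤ m ∧
    Located ℓ (E.tree.leafOf x) d k (1 + 2 * d * m) (τ.regs 9)) ∧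
    Test.eval E τ (.lt 5 4) = false) ?_ (by omega) ?_
  · refine Runs.seq (Runs.copy (by rw [hr.2.2.2]; omega) (Runs.seq (Runs.copy
      (by simp [hr.2.2.1]; omega) (Runs.loop _ _ _ (fun _ _ h => h) ?_ ?_))))
    · rintro k τ ⟨hs, h5, hk, h9⟩ ht
      obtain ⟨ep, eb, es, eq, er⟩ := id hs
      have hr' := hr.of_same er
      have hkm : k < m := by
        simp only [Test.eval, h5, hr'.2.2.2, decide_eq_true_eq] at ht
        exact lt_of_add_mul_lt ht
      obtain ⟨y, hy, hyl⟩ := hℓ k hkm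
      refine ⟨hkm, runs_identifyStep (σ := τ.tick) (y := y) hr' hkm hmem (by simp [ep, hx])
        (by simp [ep, hy]) hyl h5 h9 fun υ h1 h2 h3 => ⟨?_, h2, hkm, h3⟩⟩
      exact ⟨h1.1.trans ep, fun c hc => (h1.2.1 c hc).trans (eb c hc), h1.2.2.1.trans es,
        h1.2.2.2.1.trans (by simp [eq, add_assoc]), fun r h => (h1.2.2.2.2 r h).trans (er r h)⟩
    · refine ⟨⟨rfl, fun _ _ => rfl, rfl, rfl, fun r hr => ?_⟩, ?_, Nat.zero_le _, ?_⟩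
      · simp [show r ≠ 5 by omega, show r ≠ 9 by omega]
      · simp [hr.2.2.1]
      · exact .inr ⟨by simp, by simp [hr.2.2.2]⟩
  · rintro τ ⟨k, ⟨hs, h5, hk, h9⟩, ht⟩
    have hkm : k = m := by
      simp only [Test.eval, h5, (hr.of_same hs.2.2.2.2).2.2.2, decide_eq_false_iff_not] at ht
      exact eq_of_not_add_mul_lt hd hk ht
    subst hkm
    exact hQ τ hs h9

theorem runs_extend {a b : ℕ} {Q : LState d → Prop} (hmem : σ.regs 7 < E.mem)
    (hQ : ∀ τ, τ.pts = Function.update σ.pts (σ.regs 7)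
        (if leAt (σ.pts (σ.regs a)) (σ.pts (σ.regs b)) (σ.regs 8) = true then σ.pts (σ.regs 7)
          else σ.pts (σ.regs 2)) → τ.bits = σ.bits → τ.samples = σ.samples →
      τ.queries = σ.queries → (∀ r < 11, τ.regs r = σ.regs r) → Q τ) :
    Runs E (.ite (.coordLe a b 8) skip (.instr (.copyPoint 2 7))) σ 2 Q := by
  refine Runs.ite (T := 1) (fun h => runs_skip (hQ _ ?_ rfl rfl rfl fun r hr => ?_))
    (fun h => Runs.copyPoint hmem (hQ _ ?_ rfl rfl rfl fun r hr => rfl)) <;>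
    rw [Test.eval_coordLe] at h
  · simp [h]
  · simp [hr.ne]
  · simp [h]

/-- The cells in the block at `q` are extended to the point in cell `0` in the coordinates below
`k`, all other cells are unchanged. -/
def Extended (pts pts' : ℕ → Option (Point d)) (q k : ℕ) : Prop :=
  (∀ j < k, pts' (q + 2 * j) =
      (if leAt (pts (q + 2 * j)) (pts 0) j = true then pts (q + 2 * j) else pts 0) ∧
    pts' (q + 2 * j + 1) =
      (if leAt (pts 0) (pts (q + 2 * j + 1)) j = true then pts (q + 2 * j + 1) else pts 0)) ∧
  ∀ c, c < q ∨ q + 2 * k ≤ c → pts' c = pts c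

theorem runs_updateStep {q k : ℕ} {pts : ℕ → Option (Point d)} {Q : LState d → Prop}
    (hq : 0 < q) (hp : Extended pts σ.pts q k) (h2 : σ.regs 2 = 0) (h3 : σ.regs 3 = 1)
    (h7 : σ.regs 7 = q + 2 * k) (h8 : σ.regs 8 = k) (hmem : q + 2 * k + 2 ≤ E.mem)
    (hQ : ∀ τ, Extended pts τ.pts q (k + 1) → τ.bits = σ.bits → τ.samples = σ.samples →
      τ.queries = σ.queries → (∀ r < 5, τ.regs r = σ.regs r) → τ.regs 7 = q + 2 * (k + 1) →
      τ.regs 8 = k + 1 → Q τ) :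
    Runs E updateStep σ 7 Q := by
  refine Runs.seq (T₁ := 2) (runs_extend (by omega) fun τ ep eb es eq er =>
    Runs.seq (T₁ := 1) ?_)
  have e2 := er 2 (by norm_num)
  have e3 := er 3 (by norm_num)
  have e7 := er 7 (by norm_num)
  have e8 := er 8 (by norm_num)
  refine Runs.add (by omega) (Runs.seq (T₁ := 2) (runs_extend (by simp; omega)
    fun υ fp fb fs fq fr => ?_))
  have f2 := fr 2 (by norm_num)
  have f3 := fr 3 (by norm_num)
  have f7 := fr 7 (by norm_num)
  have f8 := fr 8 (by norm_num)
  simp at f2 f3 f7 f8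
  have hA := hp.2 (q + 2 * k) (by omega)
  have hB := hp.2 (q + 2 * k + 1) (by omega)
  have h0 := hp.2 0 (by omega)
  refine Runs.seq (T₁ := 1) (Runs.add (by omega) (Runs.add (by simp; omega)
    (hQ _ ?_ ?_ ?_ ?_ ?_ ?_ ?_)))
  · have hυ : υ.pts = Function.update (Function.update σ.pts (q + 2 * k)
        (if leAt (pts (q + 2 * k)) (pts 0) k = true then pts (q + 2 * k) else pts 0))
        (q + 2 * k + 1)
        (if leAt (pts 0) (pts (q + 2 * k + 1)) k = true then pts (q + 2 * k + 1) else pts 0) := by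
      -- Blocks start at positive addresses, so the current point in cell `0` survives the first
      -- write and is still available for the second comparison.
      have hne : 0 ≠ q + 2 * k := by omega
      simp [fp, ep, e2, e3, e7, e8, h2, h3, h7, h8, hA, hB, h0, Function.update_of_ne hne]
    refine ⟨fun j hj => ?_, fun c hc => ?_⟩
    · rcases Nat.lt_succ_iff_lt_or_eq.1 hj with hj | rfl
      · have := hp.1 j hj
        simp [hυ, show q + 2 * j ≠ q + 2 * k + 1 by omega,
          show q + 2 * j + 1 ≠ q + 2 * k by omega, show j ≠ k by omega, this.1, this.2]
      · simp [hυ]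
    · simp [hυ, show c ≠ q + 2 * k + 1 by omega,
        show c ≠ q + 2 * k by omega]
      exact hp.2 c (by omega)
  · simp [fb, eb]
  · simp [fs, es]
  · simp [fq, eq]
  · intro r hr
    have h1 := fr r (by omega)
    have h2 := er r (by omega)
    simp [show r ≠ 7 by omega, show r ≠ 8 by omega] at h1 ⊢
    rw [h1, h2]
  · simp; omega
  · simp; omega

theorem runs_update {q : ℕ} {Q : LState d → Prop} (hq : 0 < q) (h0 : σ.regs 0 = d)
    (h2 : σ.regs 2 = 0) (h3 : σ.regs 3 = 1) (h9 : σ.regs 9 = q) (hmem : q + 2 * d ≤ E.mem)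
    (hQ : ∀ τ, Extended σ.pts τ.pts q d → τ.bits = σ.bits → τ.samples = σ.samples →
      τ.queries = σ.queries → (∀ r < 5, τ.regs r = σ.regs r) → Q τ) :
    Runs E update σ (d * 8 + 3) Q := by
  unfold update
  refine Runs.mono (T := d * (7 + 1) + 1 + 1 + 1) (Q := fun τ => ∃ k, (Extended σ.pts τ.pts q k ∧
    τ.bits = σ.bits ∧ τ.samples = σ.samples ∧ τ.queries = σ.queries ∧
    (∀ r < 5, τ.regs r = σ.regs r) ∧ τ.regs 7 = q + 2 * k ∧ τ.regs 8 = k ∧ k ≤ d) ∧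
    Test.eval E τ (.lt 8 0) = false) ?_ (by omega) ?_
  · refine Runs.seq (Runs.copy (by omega) (Runs.seq (Runs.const (by omega)
      (Runs.loop _ _ _ (fun _ _ h => h) ?_ ?_))))
    · rintro k τ ⟨hp, hb, hs, hu, hr, h7, h8, hk⟩ ht
      have hkd : k < d := by simpa [Test.eval, h8, hr, h0] using ht
      refine ⟨hkd, runs_updateStep (σ := τ.tick) hq hp ((hr 2 (by norm_num)).trans h2)
        ((hr 3 (by norm_num)).trans h3) h7 h8 (by omega) fun υ g1 g2 g3 g4 g5 g6 g7 =>
          ⟨g1, g2.trans hb, g3.trans hs, g4.trans hu, fun r h => (g5 r h).trans (hr r h), g6, g7,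
            hkd⟩⟩
    · refine ⟨⟨by simp, fun _ _ => rfl⟩, rfl, rfl, rfl, fun r hr => ?_, by simp [h9], by simp,
        Nat.zero_le _⟩
      simp [show r ≠ 7 by omega, show r ≠ 8 by omega]
  · rintro τ ⟨k, ⟨hp, hb, hs, hu, hr, h7, h8, hk⟩, ht⟩
    have hkd : k = d := by
      simp [Test.eval, h8, hr, h0] at ht
      omega
    subst hkd
    exact hQ τ hp hb hs hu hr

end BoxLearner

/-! ### The memory layout and its preservation -/

namespace BoxLearner

variable {d : ℕ}

/-- The cell content `o` is one of the first `i` samples in the leaf `l`, with the least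
coordinate `j` among these. -/
def IsLow (t : DecisionTree d) (ω : ℕ → Point d) (i : ℕ) (l : List Bool) (j : Fin d)
    (o : Option (Point d)) : Prop :=
  ∃ a < i, o = some (ω a) ∧ t.leafOf (ω a) = l ∧ ∀ a' < i, t.leafOf (ω a') = l → ω a j ≤ ω a' j

/-- The cell content `o` is one of the first `i` samples in the leaf `l`, with the greatest
coordinate `j` among these. -/
def IsHigh (t : DecisionTree d) (ω : ℕ → Point d) (i : ℕ) (l : List Bool) (j : Fin d)
    (o : Option (Point d)) : Prop :=
  ∃ a < i, o = some (ω a) ∧ t.leafOf (ω a) = l ∧ ∀ a' < i, t.leafOf (ω a') = l → ω a' j ≤ ω a j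

variable {t : DecisionTree d} {ω : ℕ → Point d} {i m : ℕ} {ℓ : ℕ → List Bool}
  {pts pts' : ℕ → Option (Point d)} {bits bits' : ℕ → Bool}

/-- An empty cell compares as `false` and is therefore filled, so a fresh leaf needs no
initialisation of its own. -/
theorem IsLow.extend {l : List Bool} {j : Fin d} {o : Option (Point d)}
    (h : (o = none ∧ ∀ a < i, t.leafOf (ω a) ≠ l) ∨ IsLow t ω i l j o)
    (hl : t.leafOf (ω i) = l) :
    IsLow t ω (i + 1) l j (if leAt o (some (ω i)) j = true then o else some (ω i)) := by
  rcases h with ⟨rfl, h⟩ | ⟨a, ha, rfl, hal, hmin⟩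
  · refine ⟨i, by omega, by simp [leAt], hl, fun a' ha' hl' => ?_⟩
    rcases Nat.lt_succ_iff_lt_or_eq.1 ha' with ha' | rfl
    · exact absurd hl' (h a' ha')
    · exact le_rfl
  · rw [leAt_some]
    by_cases hle : ω a j ≤ ω i j
    · refine ⟨a, by omega, by simp [hle], hal, fun a' ha' hl' => ?_⟩
      rcases Nat.lt_succ_iff_lt_or_eq.1 ha' with ha' | rfl
      · exact hmin a' ha' hl'
      · exact hle
    · refine ⟨i, by omega, by simp [hle], hl, fun a' ha' hl' => ?_⟩
      rcases Nat.lt_succ_iff_lt_or_eq.1 ha' with ha' | rfl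
      · exact (not_le.1 hle).le.trans (hmin a' ha' hl')
      · exact le_rfl

theorem IsHigh.extend {l : List Bool} {j : Fin d} {o : Option (Point d)}
    (h : (o = none ∧ ∀ a < i, t.leafOf (ω a) ≠ l) ∨ IsHigh t ω i l j o)
    (hl : t.leafOf (ω i) = l) :
    IsHigh t ω (i + 1) l j (if leAt (some (ω i)) o j = true then o else some (ω i)) := by
  rcases h with ⟨rfl, h⟩ | ⟨a, ha, rfl, hal, hmax⟩
  · refine ⟨i, by omega, by simp [leAt], hl, fun a' ha' hl' => ?_⟩
    rcases Nat.lt_succ_iff_lt_or_eq.1 ha' with ha' | rfl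
    · exact absurd hl' (h a' ha')
    · exact le_rfl
  · rw [leAt_some]
    by_cases hle : ω i j ≤ ω a j
    · refine ⟨a, by omega, by simp [hle], hal, fun a' ha' hl' => ?_⟩
      rcases Nat.lt_succ_iff_lt_or_eq.1 ha' with ha' | rfl
      · exact hmax a' ha' hl'
      · exact hle
    · refine ⟨i, by omega, by simp [hle], hl, fun a' ha' hl' => ?_⟩
      rcases Nat.lt_succ_iff_lt_or_eq.1 ha' with ha' | rfl
      · exact (hmax a' ha' hl').trans (not_le.1 hle).le
      · exact le_rfl

/-- A new sample leaves a minimum intact if it lies in another leaf or is not below some earlier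
sample of this leaf. -/
theorem IsLow.succ {l : List Bool} {j : Fin d} {o : Option (Point d)} (h : IsLow t ω i l j o)
    (hi : t.leafOf (ω i) = l → ∃ a < i, t.leafOf (ω a) = l ∧ ω a j ≤ ω i j) :
    IsLow t ω (i + 1) l j o := by
  obtain ⟨a, ha, ho, hal, hmin⟩ := h
  refine ⟨a, by omega, ho, hal, fun a' ha' hl' => ?_⟩
  rcases Nat.lt_succ_iff_lt_or_eq.1 ha' with ha' | rfl
  · exact hmin a' ha' hl'
  · obtain ⟨c, hc, hcl, hcj⟩ := hi hl'
    exact (hmin c hc hcl).trans hcj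

theorem IsHigh.succ {l : List Bool} {j : Fin d} {o : Option (Point d)} (h : IsHigh t ω i l j o)
    (hi : t.leafOf (ω i) = l → ∃ a < i, t.leafOf (ω a) = l ∧ ω i j ≤ ω a j) :
    IsHigh t ω (i + 1) l j o := by
  obtain ⟨a, ha, ho, hal, hmax⟩ := h
  refine ⟨a, by omega, ho, hal, fun a' ha' hl' => ?_⟩
  rcases Nat.lt_succ_iff_lt_or_eq.1 ha' with ha' | rfl
  · exact hmax a' ha' hl'
  · obtain ⟨c, hc, hcl, hcj⟩ := hi hl'
    exact hcj.trans (hmax c hc hcl)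

/-- The memory represents the boxes spanned by the first `i` samples in the `m` leaves that they
reach; block number `b` belongs to the leaf `ℓ b`. -/
structure Layout (t : DecisionTree d) (ω : ℕ → Point d) (i m : ℕ) (ℓ : ℕ → List Bool)
    (pts : ℕ → Option (Point d)) (bits : ℕ → Bool) : Prop where
  inj : ∀ b < m, ∀ b' < m, ℓ b = ℓ b' → b = b'
  hit : ∀ a < i, ∃ b < m, ℓ b = t.leafOf (ω a)
  low : ∀ b < m, ∀ j : Fin d, IsLow t ω i (ℓ b) j (pts (1 + 2 * d * b + 2 * j))
  high : ∀ b < m, ∀ j : Fin d, IsHigh t ω i (ℓ b) j (pts (1 + 2 * d * b + 2 * j + 1))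
  label : ∀ b < m, ∀ x, t.leafOf x = ℓ b → bits (1 + 2 * d * b) = t.label x
  empty : ∀ c, 1 + 2 * d * m ≤ c → pts c = none

namespace Layout

theorem zero (bits : ℕ → Bool) (ω : ℕ → Point d) :
    Layout t ω 0 0 (fun _ => []) (fun _ => none) bits where
  inj := by simp
  hit := by simp
  low := by simp
  high := by simp
  label := by simp
  empty := by simp

/-- Cell `0` of either tape is scratch space: all blocks start at address `1` or later. -/
theorem congr (h : Layout t ω i m ℓ pts bits) (hp : ∀ c, c ≠ 0 → pts' c = pts c)
    (hb : ∀ c, c ≠ 0 → bits' c = bits c) : Layout t ω i m ℓ pts' bits' where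
  inj := h.inj
  hit := h.hit
  low b hb j := by rw [hp _ (by omega)]; exact h.low b hb j
  high b hb j := by rw [hp _ (by omega)]; exact h.high b hb j
  label b hm x hx := by rw [hb _ (by omega)]; exact h.label b hm x hx
  empty c hc := by rw [hp _ (by omega)]; exact h.empty c hc

/-- Each block belongs to a different leaf, and that leaf is actually reached by some sample. -/
theorem le_size (hd : 0 < d) (h : Layout t ω i m ℓ pts bits) : m ≤ t.size := by
  refine le_trans ?_ t.card_leaves_le
  rw [← Finset.card_range m]
  refine Finset.card_le_card_of_injOn ℓ (fun b hb => ?_) fun b hb b' hb' e =>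
    h.inj b (by simpa using hb) b' (by simpa using hb') e
  obtain ⟨a, -, -, ha, -⟩ := h.low b (by simpa using hb) ⟨0, hd⟩
  simp [← ha, t.leafOf_mem_leaves]

/-- The bridge between machine and geometry. Passing the test puts the point between samples of one
leaf, hence in that leaf, although no query is made. Conversely, the stored extremes are at least as
far out as any samples that witness covering. -/
theorem inBlock_iff (hd : 0 < d) (h : Layout t ω i m ℓ pts bits) {x : Point d}
    (hx : pts 0 = some x) {b : ℕ} (hb : b < m) :
    InBlock pts (1 + 2 * d * b) d ↔ t.leafOf x = ℓ b ∧ t.Covers i ω x := by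
  constructor
  · intro hin
    have hj : ∀ j : Fin d, (∃ a < i, t.leafOf (ω a) = ℓ b ∧ ω a j ≤ x j) ∧
        ∃ a < i, t.leafOf (ω a) = ℓ b ∧ x j ≤ ω a j := by
      intro j
      obtain ⟨h1, h2⟩ := hin j j.2
      obtain ⟨a, ha, hoa, hal, -⟩ := h.low b hb j
      obtain ⟨c, hc, hoc, hcl, -⟩ := h.high b hb j
      rw [hoa, hx, leAt_some, decide_eq_true_eq] at h1
      rw [hoc, hx, leAt_some, decide_eq_true_eq] at h2
      exact ⟨⟨a, ha, hal, h1⟩, c, hc, hcl, h2⟩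
    have hl : t.leafOf x = ℓ b := t.leafOf_eq_of_between hd {y | t.leafOf y = ℓ b} x (ℓ b)
      (fun a ha => ha) fun j =>
        let ⟨⟨a, _, h1, h2⟩, c, _, h3, h4⟩ := hj j
        ⟨⟨ω a, h1, h2⟩, ω c, h3, h4⟩
    exact ⟨hl, by unfold DecisionTree.Covers; rwa [hl]⟩
  · rintro ⟨hl, hcov⟩ j hjd
    obtain ⟨⟨a, ha, hal, h1⟩, c, hc, hcl, h2⟩ := hcov ⟨j, hjd⟩
    rw [hl] at hal hcl
    obtain ⟨a', ha', hoa, -, hmin⟩ := h.low b hb ⟨j, hjd⟩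
    obtain ⟨c', hc', hoc, -, hmax⟩ := h.high b hb ⟨j, hjd⟩
    simp only at hoa hoc
    refine ⟨?_, ?_⟩
    · rw [hoa, hx, leAt_some _ _ ⟨j, hjd⟩, decide_eq_true_eq]
      exact (hmin a ha hal).trans h1
    · rw [hoc, hx, leAt_some _ _ ⟨j, hjd⟩, decide_eq_true_eq]
      exact h2.trans (hmax c hc hcl)

theorem bits_eq_label (hd : 0 < d) (h : Layout t ω i m ℓ pts bits) {x : Point d}
    (hx : pts 0 = some x) (b : ℕ) (hb : b < m) (hin : InBlock pts (1 + 2 * d * b) d) :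
    bits (1 + 2 * d * b) = t.label x :=
  h.label b hb x ((h.inBlock_iff hd hx hb).1 hin).1

open scoped Classical in
theorem prediction_eq (hd : 0 < d) (h : Layout t ω i m ℓ pts bits) {x : Point d}
    (hx : pts 0 = some x) (v : Bool) :
    prediction pts m v = if t.Covers i ω x then (if v then 2 else 1) else 0 := by
  have : (∃ b < m, InBlock pts (1 + 2 * d * b) d) ↔ t.Covers i ω x := by
    constructor
    · rintro ⟨b, hb, hin⟩
      exact ((h.inBlock_iff hd hx hb).1 hin).2
    · intro hcov
      obtain ⟨a, ha, hal, -⟩ := (hcov ⟨0, hd⟩).1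
      obtain ⟨b, hb, hbl⟩ := h.hit a ha
      exact ⟨b, hb, (h.inBlock_iff hd hx hb).2 ⟨by rw [hbl, hal], hcov⟩⟩
  simp only [prediction, this]

/-- A covered sample lies between earlier samples of its leaf in each coordinate, so no extreme
changes and no new leaf appears; skipping it loses nothing. -/
theorem succ_of_covers (hd : 0 < d) (h : Layout t ω i m ℓ pts bits)
    (hcov : t.Covers i ω (ω i)) : Layout t ω (i + 1) m ℓ pts bits where
  inj := h.inj
  hit a ha := by
    rcases Nat.lt_succ_iff_lt_or_eq.1 ha with ha | rfl
    · exact h.hit a ha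
    · obtain ⟨c, hc, hcl, -⟩ := (hcov ⟨0, hd⟩).1
      rw [← hcl]
      exact h.hit c hc
  low b hb j := (h.low b hb j).succ fun hl => by rw [← hl]; exact (hcov j).1
  high b hb j := (h.high b hb j).succ fun hl => by rw [← hl]; exact (hcov j).2
  label := h.label
  empty := h.empty

theorem mul_add_lt_or_le {b b₀ : ℕ} (hne : b ≠ b₀) {a c : ℕ} (hc : c < 2 * d)
    (ha : a = 1 + 2 * d * b + c) : a < 1 + 2 * d * b₀ ∨ 1 + 2 * d * b₀ + 2 * d ≤ a := by
  rcases lt_or_gt_of_ne hne with hlt | hlt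
  · have := add_mul_le_of_lt (d := d) hlt
    omega
  · have := add_mul_le_of_lt (d := d) hlt
    omega

/-- Common core for a known and for a fresh leaf: nothing is assumed about the label of block `b₀`,
and its extremes are either correct or absent. -/
theorem succ_of_extended (hd : 0 < d) {b₀ : ℕ} (hinj : ∀ b < m, ∀ b' < m, ℓ b = ℓ b' → b = b')
    (hhit : ∀ a < i, ∃ b < m, ℓ b = t.leafOf (ω a)) (hb₀ : b₀ < m) (hl : t.leafOf (ω i) = ℓ b₀)
    (hlow : ∀ b < m, b ≠ b₀ → ∀ j : Fin d, IsLow t ω i (ℓ b) j (pts (1 + 2 * d * b + 2 * j)))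
    (hhigh : ∀ b < m, b ≠ b₀ → ∀ j : Fin d,
      IsHigh t ω i (ℓ b) j (pts (1 + 2 * d * b + 2 * j + 1)))
    (hlow₀ : ∀ j : Fin d, (pts (1 + 2 * d * b₀ + 2 * j) = none ∧ ∀ a < i, t.leafOf (ω a) ≠ ℓ b₀) ∨
      IsLow t ω i (ℓ b₀) j (pts (1 + 2 * d * b₀ + 2 * j)))
    (hhigh₀ : ∀ j : Fin d,
      (pts (1 + 2 * d * b₀ + 2 * j + 1) = none ∧ ∀ a < i, t.leafOf (ω a) ≠ ℓ b₀) ∨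
      IsHigh t ω i (ℓ b₀) j (pts (1 + 2 * d * b₀ + 2 * j + 1)))
    (hlabel : ∀ b < m, b ≠ b₀ → ∀ x, t.leafOf x = ℓ b → bits (1 + 2 * d * b) = t.label x)
    (hempty : ∀ c, 1 + 2 * d * m ≤ c → pts c = none)
    (h0 : pts 0 = some (ω i)) (hext : Extended pts pts' (1 + 2 * d * b₀) d)
    (hbit : bits' (1 + 2 * d * b₀) = t.label (ω i))
    (hbits : ∀ c, c ≠ 0 → c ≠ 1 + 2 * d * b₀ → bits' c = bits c) :
    Layout t ω (i + 1) m ℓ pts' bits' where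
  inj := hinj
  hit a ha := by
    rcases Nat.lt_succ_iff_lt_or_eq.1 ha with ha | rfl
    · exact hhit a ha
    · exact ⟨b₀, hb₀, hl.symm⟩
  low b hb j := by
    rcases eq_or_ne b b₀ with rfl | hne
    · rw [(hext.1 j j.2).1, h0]
      exact IsLow.extend (hlow₀ j) hl
    · rw [hext.2 _ (mul_add_lt_or_le hne (c := 2 * j) (by omega) rfl)]
      exact (hlow b hb hne j).succ fun e => absurd (hinj b hb b₀ hb₀ (e.symm.trans hl)) hne
  high b hb j := by
    rcases eq_or_ne b b₀ with rfl | hne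
    · rw [(hext.1 j j.2).2, h0]
      exact IsHigh.extend (hhigh₀ j) hl
    · rw [hext.2 (1 + 2 * d * b + 2 * j + 1)
        (mul_add_lt_or_le hne (c := 2 * j + 1) (by omega) rfl)]
      exact (hhigh b hb hne j).succ fun e => absurd (hinj b hb b₀ hb₀ (e.symm.trans hl)) hne
  label b hb x hx := by
    rcases eq_or_ne b b₀ with rfl | hne
    · rw [hbit]
      exact t.label_eq_of_leafOf_eq (hl.trans hx.symm)
    · have hb' : 1 + 2 * d * b ≠ 1 + 2 * d * b₀ := fun e =>
        hne (Nat.eq_of_mul_eq_mul_left (by omega : 0 < 2 * d) (by omega))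
      rw [hbits _ (by omega) hb']
      exact hlabel b hb hne x hx
  empty c hc := by
    have := add_mul_le_of_lt (d := d) hb₀
    rw [hext.2 c (.inr (by omega))]
    exact hempty c hc

theorem succ_of_located (hd : 0 < d) (h : Layout t ω i m ℓ pts bits) {q : ℕ}
    (hq : Located ℓ (t.leafOf (ω i)) d m (1 + 2 * d * m) q) (h0 : pts 0 = some (ω i))
    (hext : Extended pts pts' q d) (hbit : bits' q = t.label (ω i))
    (hbits : ∀ c, c ≠ 0 → c ≠ q → bits' c = bits c) :
    ∃ ℓ', Layout t ω (i + 1) (if q < 1 + 2 * d * m then m else m + 1) ℓ' pts' bits' := by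
  rcases hq with ⟨b₀, hb₀, hl, rfl⟩ | ⟨hne, rfl⟩
  · have := add_mul_le_of_lt (d := d) hb₀
    rw [if_pos (by omega)]
    exact ⟨ℓ, succ_of_extended hd h.inj h.hit hb₀ hl.symm (fun b hb _ => h.low b hb)
      (fun b hb _ => h.high b hb) (fun j => .inr (h.low b₀ hb₀ j))
      (fun j => .inr (h.high b₀ hb₀ j)) (fun b hb _ => h.label b hb) h.empty h0 hext hbit hbits⟩
  · rw [if_neg (lt_irrefl _)]
    have hlt : ∀ b < m + 1, b ≠ m → b < m := fun b hb hbm => by omega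
    have hℓ : ∀ b < m, Function.update ℓ m (t.leafOf (ω i)) b = ℓ b := fun b hb =>
      Function.update_of_ne hb.ne _ _
    -- Every earlier sample has its leaf among the blocks, so a leaf without a block has had no
    -- sample, and the block allocated to it consists of empty cells.
    have hfresh : ∀ a < i, t.leafOf (ω a) ≠ t.leafOf (ω i) := by
      intro a ha e
      obtain ⟨b, hb, hbl⟩ := h.hit a ha
      exact hne b hb (hbl.trans e)
    refine ⟨Function.update ℓ m (t.leafOf (ω i)), succ_of_extended hd ?_ ?_ (Nat.lt_succ_self m)
      (by simp) ?_ ?_ ?_ ?_ ?_ ?_ h0 hext hbit hbits⟩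
    · intro b hb b' hb' e
      rcases Nat.lt_succ_iff_lt_or_eq.1 hb with hb | rfl <;>
        rcases Nat.lt_succ_iff_lt_or_eq.1 hb' with hb' | rfl
      · rw [hℓ b hb, hℓ b' hb'] at e
        exact h.inj b hb b' hb' e
      · rw [hℓ b hb, Function.update_self] at e
        exact absurd e (hne b hb)
      · rw [hℓ b' hb', Function.update_self] at e
        exact absurd e.symm (hne b' hb')
      · rfl
    · intro a ha
      obtain ⟨b, hb, hbl⟩ := h.hit a ha
      exact ⟨b, by omega, by rw [hℓ b hb, hbl]⟩
    · intro b hb hbm j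
      rw [hℓ b (hlt b hb hbm)]
      exact h.low b (hlt b hb hbm) j
    · intro b hb hbm j
      rw [hℓ b (hlt b hb hbm)]
      exact h.high b (hlt b hb hbm) j
    · intro j
      rw [Function.update_self]
      exact .inl ⟨h.empty _ (by omega), hfresh⟩
    · intro j
      rw [Function.update_self]
      exact .inl ⟨h.empty _ (by omega), hfresh⟩
    · intro b hb hbm x hx
      rw [hℓ b (hlt b hb hbm)] at hx
      exact h.label b (hlt b hb hbm) x hx
    · intro c hc
      have := add_mul_le_of_lt (d := d) (show m < m + 1 by omega)
      exact h.empty c (by omega)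

end Layout

end BoxLearner

theorem DecisionTree.size_pos {d : ℕ} (t : DecisionTree d) : 0 < t.size := by
  induction t with
  | leaf => exact Nat.one_pos
  | node _ _ _ _ _ ih1 ih2 => exact Nat.add_pos_left ih1 _

/-! ### Correctness and cost of training and classification -/

namespace BoxLearner

variable {d : ℕ} {E : Env d} {σ : LState d}

/-- Makes room for a new block if `r9` is the first free address. -/
theorem runs_advance {m q : ℕ} {Q : LState d → Prop} (hr : Ready m σ) (h9 : σ.regs 9 = q)
    (hmem : 2 * d * (m + 1) + 2 ≤ E.mem)
    (hQ : ∀ τ, τ.pts = σ.pts → τ.bits = σ.bits → τ.samples = σ.samples → τ.queries = σ.queries →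
      τ.regs 9 = q → Ready (if q < 1 + 2 * d * m then m else m + 1) τ → Q τ) :
    Runs E (.ite (.lt 9 4) skip (.seq (.instr (.add 4 0)) (.instr (.add 4 0)))) σ 3 Q := by
  obtain ⟨r0, r2, r3, r4⟩ := hr
  have hm : 2 * d * (m + 1) = 2 * d * m + 2 * d := by ring
  refine Runs.ite (T := 2) (fun ht => ?_) fun ht => ?_ <;>
    simp only [Test.eval, h9, r4, decide_eq_true_eq, decide_eq_false_iff_not] at ht
  · refine Runs.mono (T := 1) (runs_skip (hQ _ rfl rfl rfl rfl (by simpa using h9) ?_))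
      (by norm_num) fun _ h => h
    rw [if_pos ht]
    exact ⟨by simpa using r0, by simpa using r2, by simpa using r3, by simpa using r4⟩
  · refine Runs.seq (T₁ := 1) (Runs.add (by simp [r4, r0]; omega)
      (Runs.add (by simp [r4, r0]; omega) (hQ _ rfl rfl rfl rfl (by simpa using h9) ?_)))
    rw [if_neg ht]
    refine ⟨by simpa using r0, by simpa using r2, by simpa using r3, ?_⟩
    simp [r4, r0, hm]
    omega

/-- The `m` same-leaf queries and one label query account for `m + 1`. Memory for one block more
than the tree has leaves is assumed, so `m ≤ size` suffices and no separate argument is needed that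
a fresh leaf leaves room. For a known leaf the label is queried again and overwritten with the same
value. -/
theorem runs_learn {i m : ℕ} {ℓ : ℕ → List Bool} {Q : LState d → Prop} (hd : 0 < d)
    (hr : Ready m σ) (hL : Layout E.tree E.stream i m ℓ σ.pts σ.bits)
    (hx : σ.pts 0 = some (E.stream i)) (hmem : 2 * d * (E.tree.size + 1) + 2 ≤ E.mem)
    (hQ : ∀ τ m' ℓ', Ready m' τ → Layout E.tree E.stream (i + 1) m' ℓ' τ.pts τ.bits →
      τ.samples = σ.samples → τ.queries = σ.queries + (m + 1) → Q τ) :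
    Runs E learn σ (m * 6 + 8 * d + 10) Q := by
  have hm := hL.le_size hd
  have hmm : 2 * d * (m + 1) ≤ 2 * d * (E.tree.size + 1) := Nat.mul_le_mul_left _ (by omega)
  have hm1 : 2 * d * (m + 1) = 2 * d * m + 2 * d := by ring
  unfold learn
  refine Runs.mono (T := d * 8 + 3 + 3 + 1 + (m * 6 + 3)) ?_ (by omega) fun _ h => h
  refine Runs.seq (runs_identify (ℓ := ℓ) hd hr (by omega) hx (fun b hb => ?_) fun τ hs h9 => ?_)
  · obtain ⟨a, -, ho, hl, -⟩ := hL.low b hb ⟨0, hd⟩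
    exact ⟨_, by simpa using ho, hl⟩
  obtain ⟨ep, eb, es, eq, er⟩ := hs
  have hr' := hr.of_same er
  obtain ⟨q, hq⟩ : ∃ q, τ.regs 9 = q := ⟨_, rfl⟩
  rw [hq] at h9
  have hqle : 0 < q ∧ q ≤ 1 + 2 * d * m := by
    rcases h9 with ⟨b, hb, -, h⟩ | ⟨-, h⟩
    · have := add_mul_le_of_lt (d := d) hb
      omega
    · omega
  refine Runs.seq (Runs.queryLabel (x := E.stream i) (by rw [hr'.2.1, ep, hx]) (by omega)
    (Runs.seq (runs_advance (q := q) hr' hq (by omega) fun υ gp gb gs gq g9 gr => ?_)))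
  refine runs_update (q := q) hqle.1 gr.1 gr.2.1 gr.2.2.1 g9 (by omega)
    fun ρ hext hb hs hu hrr => ?_
  rw [gp] at hext
  simp only [LState.answer, ep] at hext
  rw [gb] at hb
  simp only [LState.answer, hq] at hb gs gq
  obtain ⟨ℓ', hL'⟩ := hL.succ_of_located hd h9 hx hext (bits' := ρ.bits) (by simp [hb])
    (fun c hc hcq => by rw [hb, Function.update_of_ne hcq, eb c hc])
  exact hQ ρ _ ℓ' (gr.of_same hrr) hL' (by rw [hs, gs, es]) (by rw [hu, gq, eq]; ring)

/-- The memory represents the boxes of the first `i` samples, and the number of queries made so far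
is bounded in terms of the number of misses and of the cap. -/
def Invariant (E : Env d) (s : ℕ) (R : CoveringRule (Point d) (2 * d * s)) (cap i : ℕ)
    (σ : LState d) : Prop :=
  σ.samples = i ∧ σ.queries ≤ (s + 1) * R.misses i E.stream ∧ σ.queries ≤ cap + s ∧
    ∃ m ℓ, Ready m σ ∧ Layout E.tree E.stream i m ℓ σ.pts σ.bits

theorem runs_trainStep {s cap i : ℕ} (hd : 0 < d) (hs : E.tree.size ≤ s)
    (hmem : 2 * d * (s + 1) + 2 ≤ E.mem) (hI : Invariant E s (E.tree.coveringRule hs) cap i σ)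
    (hcap : σ.queries < cap) :
    Runs E trainStep σ (46 * d * s)
      (Invariant E s (E.tree.coveringRule hs) cap (i + 1)) := by
  classical
  obtain ⟨hi, hq, -, m, ℓ, hr, hL⟩ := hI
  have hmem' : 2 * d * (E.tree.size + 1) + 2 ≤ E.mem :=
    le_trans (by gcongr) hmem
  have hm : m ≤ s := (hL.le_size hd).trans hs
  have hmm : 2 * d * m ≤ 2 * d * (s + 1) := Nat.mul_le_mul_left _ (by omega)
  have hs1 : 1 ≤ s := E.tree.size_pos.trans_le hs
  -- The sum is `8 * m * d + 15 * m + 8 * d + 15`, and each of `m * d`, `m`, `d`, `1` is at most `d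
  -- * s`; `8 + 15 + 8 + 15 = 46`.
  have hT : m * 6 + 8 * d + 10 + 1 + (m * (8 * d + 9) + 3) + 1 ≤ 46 * d * s := by
    have h1 : d ≤ d * s := Nat.le_mul_of_pos_right d hs1
    have h2 : s ≤ d * s := Nat.le_mul_of_pos_left s hd
    have h3 : m * d ≤ d * s := by rw [mul_comm]; exact Nat.mul_le_mul_left d hm
    nlinarith
  have hmiss : (E.tree.coveringRule hs).misses (i + 1) E.stream =
      (E.tree.coveringRule hs).misses i E.stream +
        if E.tree.Covers i E.stream (E.stream i) then 0 else 1 := by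
    rw [CoveringRule.misses_succ]
    congr 1
    by_cases h : E.tree.Covers i E.stream (E.stream i) <;>
      simp [DecisionTree.coveringRule, h]
  unfold trainStep
  refine Runs.mono ?_ hT fun _ h => h
  refine Runs.seq (Runs.sample (by rw [hr.2.1]; omega) ?_)
  rw [hr.2.1, hi]
  have hL1 : Layout E.tree E.stream i m ℓ (σ.draw 0 (E.stream i)).pts
      (σ.draw 0 (E.stream i)).bits :=
    hL.congr (fun c hc => by simp [hc]) fun _ _ => rfl
  have hx : (σ.draw 0 (E.stream i)).pts 0 = some (E.stream i) := by simp
  refine Runs.seq (runs_scan (v := E.tree.label (E.stream i)) hd (hr.of_same fun _ _ => rfl)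
    (by omega) (hL1.bits_eq_label hd hx) fun τ hsame h6 => ?_)
  rw [hL1.prediction_eq hd hx] at h6
  obtain ⟨ep, eb, es, eq, er⟩ := hsame
  have hr' : Ready m τ := hr.of_same er
  have hL2 : Layout E.tree E.stream i m ℓ τ.pts τ.bits := by rw [ep, eb]; exact hL1
  refine Runs.ite (T := m * 6 + 8 * d + 10) (fun ht => ?_) fun ht => ?_
  · have hcov : E.tree.Covers i E.stream (E.stream i) := by
      by_contra hn
      simp [Test.eval, hr'.2.1, h6, hn] at ht
    rw [if_pos hcov, add_zero] at hmiss
    refine Runs.mono (T := 1) (runs_skip ⟨?_, ?_, ?_, m, ℓ, ?_, ?_⟩) (by omega) fun _ h => h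
    · simp [es, hi]
    · simpa [eq, hmiss] using hq
    · simp [eq]; omega
    · exact hr'.of_same fun r hr => by simp [show r ≠ 11 by omega]
    · exact hL2.succ_of_covers hd hcov
  · have hcov : ¬ E.tree.Covers i E.stream (E.stream i) := by
      intro hc
      simp only [Test.eval, hr'.2.1, h6, if_pos hc, decide_eq_false_iff_not] at ht
      split_ifs at ht <;> omega
    rw [if_neg hcov] at hmiss
    refine runs_learn (σ := τ.tick) (ℓ := ℓ) hd hr' hL2 (by simp [ep]) hmem'
      fun υ m' ℓ' gr gL gs gq => ⟨?_, ?_, ?_, m', ℓ', gr, gL⟩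
    · simp [gs, es, hi]
    · rw [hmiss, mul_add]
      simp [gq, eq]
      omega
    -- The step started strictly below the cap and made at most `s + 1` queries, hence the bound
    -- `cap + s`.
    · simp [gq, eq]
      omega

/-- The counter predicate: fewer than `n` samples and fewer than `cap` queries. -/
def control (n cap : ℕ) : ℕ → ℕ → ℕ → Bool :=
  fun _ i q => decide (i < n) && decide (q < cap)

theorem runs_train {s n cap : ℕ} (hd : 0 < d) (hs : E.tree.size ≤ s)
    (hmem : 2 * d * (s + 1) + 2 ≤ E.mem) (hctl : E.ctl = control n cap) :
    Runs E learner.train (LState.init d s) (n * (46 * d * s + 1) + 4) fun σ =>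
      ∃ i ≤ n, (i < n → cap ≤ σ.queries) ∧
        Invariant E s (E.tree.coveringRule hs) cap i σ := by
  have h1 : 1 ≤ E.mem := by omega
  refine Runs.mono (T := n * (46 * d * s + 1) + 1 + 1 + 1 + 1) (Q := fun σ => ∃ i, (i ≤ n ∧
    Invariant E s (E.tree.coveringRule hs) cap i σ) ∧ Test.eval E σ (.counters 0) = false)
    ?_ (by omega) ?_
  · refine Runs.seq (Runs.const (by omega) (Runs.seq (Runs.const h1 (Runs.seq (Runs.const h1
      (Runs.loop _ _ _ (fun _ _ h => h) ?_ ?_))))))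
    · rintro k τ ⟨hk, hI⟩ ht
      simp only [Test.eval, hctl, control, Bool.and_eq_true, decide_eq_true_eq, hI.1] at ht
      exact ⟨ht.1, (runs_trainStep (σ := τ.tick) hd hs hmem hI ht.2).mono le_rfl
        fun υ h => ⟨ht.1, h⟩⟩
    · refine ⟨Nat.zero_le _, rfl, by simp [LState.init], by simp [LState.init], 0, fun _ => [],
        ?_, Layout.zero _ _⟩
      simp [Ready, LState.init]
  · rintro σ ⟨i, ⟨hi, hI⟩, ht⟩
    refine ⟨i, hi, fun hlt => ?_, hI⟩
    simp only [Test.eval, hctl, control, hI.1, hlt, decide_true, Bool.true_and,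
      decide_eq_false_iff_not, not_lt] at ht
    exact ht

open scoped Classical in
theorem runs_classify {s cap i : ℕ} {R : CoveringRule (Point d) (2 * d * s)} (hd : 0 < d)
    (hs : E.tree.size ≤ s) (hmem : 2 * d * (s + 1) + 2 ≤ E.mem)
    (hI : Invariant E s R cap i σ) (x : Point d) :
    Runs E learner.classify (σ.load x) (21 * d * s) fun τ => τ.samples = σ.samples ∧
      τ.queries = σ.queries ∧
      τ.output = if E.tree.Covers i E.stream x then some (E.tree.label x) else none := by
  obtain ⟨-, -, -, m, ℓ, hr, hL⟩ := hI
  have hm : m ≤ s := (hL.le_size hd).trans hs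
  have hmm : 2 * d * m ≤ 2 * d * (s + 1) := Nat.mul_le_mul_left _ (by omega)
  have hs1 : 1 ≤ s := E.tree.size_pos.trans_le hs
  -- Here the sum is `8 * m * d + 9 * m + 4`, and `8 + 9 + 4 = 21`.
  have hT : 1 + (m * (8 * d + 9) + 3) ≤ 21 * d * s := by
    have h1 : d ≤ d * s := Nat.le_mul_of_pos_right d hs1
    have h2 : s ≤ d * s := Nat.le_mul_of_pos_left s hd
    have h3 : m * d ≤ d * s := by rw [mul_comm]; exact Nat.mul_le_mul_left d hm
    nlinarith
  have hL1 : Layout E.tree E.stream i m ℓ (σ.load x).pts (σ.load x).bits :=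
    hL.congr (fun c hc => by simp [LState.load, hc]) fun _ _ => rfl
  have hx : (σ.load x).pts 0 = some x := by simp [LState.load]
  refine Runs.mono ?_ hT fun _ h => h
  refine Runs.seq (runs_scan (σ := σ.load x) (v := E.tree.label x) hd hr (by omega)
    (hL1.bits_eq_label hd hx) fun τ hsame h6 => ?_)
  rw [hL1.prediction_eq hd hx] at h6
  obtain ⟨-, -, es, eq, -⟩ := hsame
  refine Runs.copy ?_ ⟨es, eq, ?_⟩
  · rw [h6]
    split_ifs <;> omega
  · by_cases hc : E.tree.Covers i E.stream x <;> cases hl : E.tree.label x <;>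
      simp [LState.output, h6, hc, hl]

end BoxLearner

/-! ### Deterministic guarantees and the main theorem -/

open BoxLearner in
open scoped Classical in
/-- The deterministic guarantees: halting within the bounds, with a hypothesis that is correct on the
points covered by the first `i` samples, where `i = n` unless the query cap was reached. -/
theorem BoxLearner.produces {d s n cap : ℕ} {E : Env d} {Q T : ℝ} (hd : 0 < d)
    (hs : E.tree.size ≤ s) (hmem : 2 * d * (s + 1) + 2 ≤ E.mem) (hctl : E.ctl = control n cap)
    (hQ : ((cap + s : ℕ) : ℝ) ≤ Q) (hT : ((n * (46 * d * s + 1) + 4 + 21 * d * s : ℕ) : ℝ) ≤ T) :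
    ∃ i ≤ n, (i < n → cap ≤ (s + 1) * (E.tree.coveringRule hs).misses i E.stream) ∧
      learner.Produces E s Q T
        fun x => if E.tree.Covers i E.stream x then some (E.tree.label x) else none := by
  obtain ⟨σ, hex, htime, i, hi, hlt, hI⟩ := runs_train hd hs hmem hctl
  have htime' : σ.time ≤ n * (46 * d * s + 1) + 4 := by simpa [LState.init] using htime
  refine ⟨i, hi, fun h => (hlt h).trans hI.2.1, σ, hex, ?_, ?_, fun x => ?_⟩
  · exact le_trans (by exact_mod_cast hI.2.2.1) hQ
  · exact le_trans (by exact_mod_cast (by omega : σ.time ≤ _)) hT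
  · obtain ⟨τ, hex', ht', h1, h2, h3⟩ := runs_classify hd hs hmem hI x
    refine ⟨τ, hex', h1, h2, le_trans ?_ hT, h3⟩
    have : τ.time ≤ σ.time + 21 * d * s := ht'
    exact_mod_cast (by omega : τ.time ≤ _)

theorem mainTheorem8 :
    ∃ (L : Learner) (C : ℕ), ∀ d s : ℕ, 1 ≤ d → 1 ≤ s →
      ∀ ε δ : ℝ, 0 < ε → ε < 1 → 0 < δ → δ < 1 →
        ∃ ctl : ℕ → ℕ → ℕ → Bool,
          L.RPULearns d s ctl ε δ
            (C * (d * s ^ 2 * max 1 (Real.log (1 / (ε * δ)))))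
            (C * (d ^ 2 * s ^ 2 * max 1 (Real.log (d * s / (ε * δ))) *
              max 1 (Real.log (1 / (ε * δ))) / ε))
            (C * d * s) := by
  classical
  -- The running time decides the constant: `144 * 41 = 5904`. Queries and memory need far less.
  refine ⟨BoxLearner.learner, 6000, fun d s hd hs ε δ hε hε1 hδ hδ1 => ?_⟩
  obtain ⟨N, v, hN, hNle, hvle, h1, h2⟩ := exists_sampling_parameters hε hε1 hδ
  set L := max 1 (Real.log (1 / (ε * δ))) with hL
  set L' := max 1 (Real.log (d * s / (ε * δ))) with hL'
  have hL1 : 1 ≤ L := le_max_left _ _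
  have hL'1 : 1 ≤ L' := le_max_left _ _
  have hk : 0 < 2 * d * s := by positivity
  have hdR : (1 : ℝ) ≤ d := by exact_mod_cast hd
  have hsR : (1 : ℝ) ≤ s := by exact_mod_cast hs
  set n := 2 * d * s * N with hn
  -- The price of `k * v` misses at `s + 1` queries each, with `k = 2 * d * s`.
  set cap := (s + 1) * (2 * d * s * v) with hcap
  refine ⟨BoxLearner.control n cap, fun h hh => ?_⟩
  have hQ : ((cap + s : ℕ) : ℝ) ≤ (6000 : ℕ) * (d * s ^ 2 * L) := by
    have h3 : ((s : ℝ) + 1) * (2 * d * s * v) ≤ (2 * s) * (2 * d * s * (21 * L)) := by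
      gcongr
      linarith
    have h4 : (s : ℝ) ≤ d * s ^ 2 * L := by
      calc (s : ℝ) = 1 * (s * 1) * 1 := by ring
        _ ≤ d * (s * s) * L := by gcongr
        _ = _ := by ring
    rw [hcap]
    push_cast
    nlinarith
  have hT : ((n * (46 * d * s + 1) + 4 + 21 * d * s : ℕ) : ℝ) ≤
      (6000 : ℕ) * (d ^ 2 * s ^ 2 * L' * L / ε) := by
    have hds : 1 ≤ d * s := Nat.mul_pos hd hs
    have h3 : n * (46 * d * s + 1) + 4 + 21 * d * s ≤ (2 * d * s * N) * (72 * (d * s)) := by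
      have h4 : 1 ≤ n := Nat.mul_pos hk hN
      have h5 : d * s ≤ n * (d * s) := Nat.le_mul_of_pos_left _ h4
      nlinarith
    calc ((n * (46 * d * s + 1) + 4 + 21 * d * s : ℕ) : ℝ)
        ≤ ((2 * d * s * N) * (72 * (d * s)) : ℕ) := by exact_mod_cast h3
      _ = 144 * (d ^ 2 * s ^ 2) * N := by push_cast; ring
      _ ≤ 144 * (d ^ 2 * s ^ 2) * (41 * L / ε) := by gcongr
      _ = 5904 * (d ^ 2 * s ^ 2 * 1 * L / ε) := by ring
      -- The factor `L'` enters only through `1 ≤ L'`: comparisons cost one step each, so the proof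
      -- needs no logarithm of `d * s`.
      _ ≤ (6000 : ℕ) * (d ^ 2 * s ^ 2 * L' * L / ε) := by
          push_cast
          gcongr
          norm_num
  have hmem : 2 * d * (s + 1) + 2 ≤ 6000 * d * s := by
    have h3 : d ≤ d * s := Nat.le_mul_of_pos_right d hs
    nlinarith
  have hprod := fun ω : ℕ → Point d => BoxLearner.produces
    (E := { tree := h, stream := ω, ctl := BoxLearner.control n cap, mem := 6000 * d * s })
    hd hh hmem rfl hQ hT
  choose i hi hcapi hP using hprod
  refine ⟨fun ω x => if h.Covers (i ω) ω x then some (h.label x) else none, hP,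
    fun ω x y hy => ?_, fun D _ => ?_⟩
  · dsimp only at hy
    split_ifs at hy
    exact (Option.some.inj hy).symm
  -- Inclusion in the failure event of the full stream of `n` samples, whose misses are defined
  -- without reference to the cap. No measurability of the stopping index `i ω` is needed.
  · refine lt_of_le_of_lt (measure_mono fun ω hω => ?_)
      ((h.coveringRule hh).measure_failure_lt D hk hε hε1 hδ hδ1 hN h1 h2)
    rw [Set.mem_ofPred_eq] at hω ⊢
    by_contra hcon
    rw [not_or, not_le] at hcon
    -- Stopping early means that the cap was reached, hence at least `2 * d * s * v` misses by then,
    -- and at least as many among all `n` samples.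
    have hin : i ω = n := by
      refine (hi ω).antisymm (not_lt.1 fun hlt => ?_)
      have h3 := hcapi ω hlt
      have h4 : (h.coveringRule hh).misses (i ω) ω ≤ (h.coveringRule hh).misses n ω :=
        (h.coveringRule hh).misses_mono ω (hi ω)
      have h5 : 2 * d * s * v ≤ (h.coveringRule hh).misses (i ω) ω :=
        Nat.le_of_mul_le_mul_left h3 (Nat.succ_pos s)
      exact absurd (h5.trans h4) hcon.1.not_ge
    refine hcon.2 ?_
    simp only [hin] at hω
    simpa [DecisionTree.coveringRule] using hω
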